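/- Notation. Write points of $\mathbb R^2$ as $(x,t)$, let $P=3t\,\partial_t+x\,\partial_x$, let $\|f\|_{H^{7/2}(\mathbb R^2)}=\|\langle D_{x,t}\rangle^{7/2}f\|_{L^2(\mathbb R^2)}$, and let $t^{1/3}$ be the real cube root. Let $a,b,c,\tilde a,\tilde b,\tilde c\in\mathbb R$, let $x_0\in\mathbb R$, $t_0\neq 0$ and $0<\varepsilon<|t_0|$, and put $I=(x_0-\varepsilon,x_0+\varepsilon)\times(t_0-\varepsilon,t_0+\varepsilon)$. Let $\psi\in C_0^\infty(\mathbb R^2)$ be real-valued with $\psi=1$ on $I$, and let $C,A_1,A_2>0$. **Proposition 4.3.** There are positive constants $c_1,A_3,A_4$, depending only on the data above, with the following property. Let $u,v$ be (real- or complex-valued) tempered distributions on $\mathbb R^2$ which on $I$ are locally square integrable functions and satisfy on $I$, in the sense of distributions, the system $$u_t+u_{xxx}+a\,uu_x+b\,vv_x+c\,(uv)_x=0,\qquad v_t+v_{xxx}+\tilde a\,uu_x+\tilde b\,vv_x+\tilde c\,(uv)_x=0,$$ where $uu_x=\tfrac12(u^2)_x$ and $vv_x=\tfrac12(v^2)_x$.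 Suppose that $$\|\psi P^ku\|_{H^{7/2}(\mathbb R^2)}\le C A_1^k (k!)^2,\qquad \|\psi P^kv\|_{H^{7/2}(\mathbb R^2)}\le C A_2^k (k!)^2,\qquad k=0,1,2,\dots$$ Then for all $k,l=0,1,2,\dots$ the distributions $\partial_x^lP^ku$ and $\partial_x^lP^kv$ are given on $I$ by functions that extend continuously to $\overline I$ (so that they have well-defined values at each time $t\in[t_0-\varepsilon,t_0+\varepsilon]$), and $$\sup_{t\in[t_0-\varepsilon,t_0+\varepsilon]}\|(t^{1/3}\partial_x)^lP^ku\|_{H^1(x_0-\varepsilon,x_0+\varepsilon)}\le c_1A_3^{k+l}[(k+l)!]^2,$$ $$\sup_{t\in[t_0-\varepsilon,t_0+\varepsilon]}\|(t^{1/3}\partial_x)^lP^kv\|_{H^1(x_0-\varepsilon,x_0+\varepsilon)}\le c_1A_4^{k+l}[(k+l)!]^2.$$ -/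

import Mathlib

open MeasureTheory TemperedDistribution
open scoped SchwartzMap LineDeriv ENNReal ContDiff Nat

noncomputable section

namespace KdVSystem

/-- The space-time plane `ℝ²`; a point `z` has space coordinate `x = z 0` and
time coordinate `t = z 1`. -/
abbrev Plane : Type := EuclideanSpace ℝ (Fin 2)

/-- The unit vector of the `x`-direction. -/
def ex : Plane := EuclideanSpace.single 0 1

/-- The unit vector of the `t`-direction. -/
def et : Plane := EuclideanSpace.single 1 1

/-- The generator of dilations `P = 3 t ∂ₜ + x ∂ₓ` acting on tempered distributions. -/
def P (u : 𝓢'(Plane, ℂ)) : 𝓢'(Plane, ℂ) :=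
  (3 : ℂ) • smulLeftCLM ℂ (fun z : Plane ↦ ((z 1 : ℝ) : ℂ)) (∂_{et} u)
    + smulLeftCLM ℂ (fun z : Plane ↦ ((z 0 : ℝ) : ℂ)) (∂_{ex} u)

/-- The powers `∂ₓ^l` acting on tempered distributions. -/
def dxPow (l : ℕ) (u : 𝓢'(Plane, ℂ)) : 𝓢'(Plane, ℂ) :=
  (fun w : 𝓢'(Plane, ℂ) ↦ ∂_{ex} w)^[l] u

/-- The product `ψ u` of a tempered distribution with a (smooth, compactly supported) cut-off
function. -/
def cutoff (ψ : Plane → ℝ) (u : 𝓢'(Plane, ℂ)) : 𝓢'(Plane, ℂ) :=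
  smulLeftCLM ℂ (fun z ↦ ((ψ z : ℝ) : ℂ)) u

/-- The norm of `H^s(ℝ²)`, i.e. the `L²` norm of `⟨D⟩^s f`; it is `∞` if `f ∉ H^s(ℝ²)`.
The infimum runs over at most one function `g ∈ L²`, the one which represents `⟨D⟩^s f`. -/
def sobolevNorm (s : ℝ) (f : 𝓢'(Plane, ℂ)) : ℝ≥0∞ :=
  ⨅ (g : Lp ℂ 2 (volume : Measure Plane))
    (_ : besselPotential Plane ℂ s f = (g : 𝓢'(Plane, ℂ))), ‖g‖ₑ

/-- `η` is a test function on the open set `U`. -/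
def IsTestOn (U : Set Plane) (η : 𝓢(Plane, ℂ)) : Prop :=
  HasCompactSupport (η : Plane → ℂ) ∧ tsupport (η : Plane → ℂ) ⊆ U

/-- On the open set `U`, the distribution `u` is given by the locally integrable function `f`. -/
def IsGivenBy (U : Set Plane) (u : 𝓢'(Plane, ℂ)) (f : Plane → ℂ) : Prop :=
  LocallyIntegrableOn f U ∧ ∀ η : 𝓢(Plane, ℂ), IsTestOn U η → u η = ∫ z, η z * f z

/-- The function `f` is locally square integrable on the open set `U`. -/
def LocallyL2On (U : Set Plane) (f : Plane → ℂ) : Prop :=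
  ∀ K : Set Plane, K ⊆ U → IsCompact K → MemLp f 2 (volume.restrict K)

/-- `∂ₜ w + ∂ₓ³ w + (a/2) ∂ₓ(f²) + (b/2) ∂ₓ(g²) + c ∂ₓ(f g) = 0` in the sense of
distributions on `U`. -/
def WeakEq (a b c : ℝ) (U : Set Plane) (w : 𝓢'(Plane, ℂ)) (f g : Plane → ℂ) : Prop :=
  ∀ η : 𝓢(Plane, ℂ), IsTestOn U η →
    (∂_{et} w + dxPow 3 w) η
      = ∫ z, ((a : ℂ) / 2 * f z ^ 2 + (b : ℂ) / 2 * g z ^ 2 + (c : ℂ) * (f z * g z)) *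
          (∂_{ex} η) z

/-- `(u, v)` is a distributional solution on the open set `U` of the coupled system
`uₜ + uₓₓₓ + a u uₓ + b v vₓ + c (u v)ₓ = 0`, `vₜ + vₓₓₓ + a' u uₓ + b' v vₓ + c' (u v)ₓ = 0`:
on `U` both are locally square integrable functions, so that the quadratic terms are defined,
and the equations, with `u uₓ = (u²)ₓ / 2` and `v vₓ = (v²)ₓ / 2`, hold against test functions. -/
def IsSolutionOn (a b c a' b' c' : ℝ) (U : Set Plane) (u v : 𝓢'(Plane, ℂ)) : Prop :=
  ∃ f g : Plane → ℂ, LocallyL2On U f ∧ LocallyL2On U g ∧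
    IsGivenBy U u f ∧ IsGivenBy U v g ∧
    WeakEq a b c U u f g ∧ WeakEq a' b' c' U v f g

/-- The open square `(x₀ - ε, x₀ + ε) × (t₀ - ε, t₀ + ε)`. -/
def square (x₀ t₀ ε : ℝ) : Set Plane :=
  {z | z 0 ∈ Set.Ioo (x₀ - ε) (x₀ + ε) ∧ z 1 ∈ Set.Ioo (t₀ - ε) (t₀ + ε)}

/-- The closed square `[x₀ - ε, x₀ + ε] × [t₀ - ε, t₀ + ε]`. -/
def closedSquare (x₀ t₀ ε : ℝ) : Set Plane :=
  {z | z 0 ∈ Set.Icc (x₀ - ε) (x₀ + ε) ∧ z 1 ∈ Set.Icc (t₀ - ε) (t₀ + ε)}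

/-- `g` is the weak derivative of `f` on the open set `J ⊆ ℝ`. -/
def HasWeakDerivOn (J : Set ℝ) (f g : ℝ → ℂ) : Prop :=
  LocallyIntegrableOn f J ∧ LocallyIntegrableOn g J ∧
    ∀ η : ℝ → ℝ, ContDiff ℝ ∞ η → HasCompactSupport η → tsupport η ⊆ J →
      ∫ x, ((deriv η x : ℝ) : ℂ) * f x = - ∫ x, ((η x : ℝ) : ℂ) * g x

/-- The norm `(‖f‖²_{L²(J)} + ‖f'‖²_{L²(J)})^{1/2}` of `H¹(J)`, with `f'` the weak derivative;
it is `∞` if `f ∉ H¹(J)`. All functions `g` in the infimum agree almost everywhere on `J`. -/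
def h1Norm (J : Set ℝ) (f : ℝ → ℂ) : ℝ≥0∞ :=
  ⨅ (g : ℝ → ℂ) (_ : HasWeakDerivOn J f g),
    (eLpNorm f 2 (volume.restrict J) ^ 2 + eLpNorm g 2 (volume.restrict J) ^ 2) ^ (1 / 2 : ℝ)

/-- The real cube root `t^{1/3}`, for `t` of either sign. -/
def cbrt (t : ℝ) : ℝ := Real.sign t * |t| ^ (1 / 3 : ℝ)

/-- The pointwise-in-time bound
`sup_{t ∈ [t₀ - ε, t₀ + ε]} ‖(t^{1/3} ∂ₓ)^l w‖_{H¹(x₀ - ε, x₀ + ε)} ≤ M`.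
For the values at a fixed time to be meaningful, `∂ₓ^l w` has to be given on the open square by a
function `V` which is continuous up to the boundary (and then `V` is unique on the closed square);
note that `(t^{1/3} ∂ₓ)^l = (t^{1/3})^l ∂ₓ^l`. -/
def PointwiseBound (x₀ t₀ ε : ℝ) (l : ℕ) (w : 𝓢'(Plane, ℂ)) (M : ℝ) : Prop :=
  ∃ V : Plane → ℂ, ContinuousOn V (closedSquare x₀ t₀ ε) ∧
    IsGivenBy (square x₀ t₀ ε) (dxPow l w) V ∧
    ⨆ t ∈ Set.Icc (t₀ - ε) (t₀ + ε),
      h1Norm (Set.Ioo (x₀ - ε) (x₀ + ε)) (fun x ↦ ((cbrt t : ℝ) : ℂ) ^ l * V !₂[x, t])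
        ≤ ENNReal.ofReal M

end KdVSystem

end

/-! Write L = ∂ₜ + ∂ₓ³ and let q be the quadratic flux of the system, so that Lu + ∂ₓq(u) = 0.
Dilation scaling gives LP = (P + 3)L and ∂ₓP = (P + 1)∂ₓ, hence L P^k u + ∂ₓ(P + 2)^k q(u) = 0 for
every k (`airy_P_apply`), and (P + 2)^k q(u) expands by Leibniz into products of the P^i u (`flux`).
Away from t = 0 the time derivative can be traded for P through 3t∂ₜ = P - x∂ₓ. The equation then
expresses ∂ₓ³P^k u through P^{k+1}u, ∂ₓP^k u and ∂ₓ of the flux, and its x-derivatives give all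
higher orders (`tower`).

Regularity: the embedding H^{7/2} ⊂ C² supplies C² representatives of P^k u on the square, with
bounds on the derivatives of order at most 2. The third x-derivative exists weakly with a continuous
value, so it is classical by mollification (`hasLineDerivAt_of_weak`). Beyond that,
differentiability is inherited from the recursion (`hasLineDerivAt_tower`).

Size: induction on l gives |∂ₓ^l P^k u| ≤ c A^{k+l} (k+l)!² (`norm_tower_le`). In products, one
power of the factorials absorbs all binomial coefficients. The number of Leibniz terms is cubic in k
+ l, while the recursion climbs two orders, from k + l + 1 to k + l + 3, which leaves A² times a
polynomial of degree four to pay for it. The H¹ norm costs one more derivative, absorbed by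
enlarging the geometric constant. -/

namespace KdVSystem

/-! ### The Sobolev embedding H^{7/2} ⊂ C² in the plane. -/

open FourierTransform in
/-- The Fourier transform of a function with two integrable moments is of class `C²`, with
derivatives bounded by the moments. -/
theorem contDiff_two_fourier {h : Plane → ℂ} {M : ℝ}
    (hm : AEStronglyMeasurable h volume)
    (hi : ∀ n : ℕ, n ≤ 2 → Integrable (fun ξ ↦ ‖ξ‖ ^ n * ‖h ξ‖))
    (hM : ∀ n : ℕ, n ≤ 2 → ∫ ξ, ‖ξ‖ ^ n * ‖h ξ‖ ≤ M) :
    ContDiff ℝ 2 (𝓕 h : Plane → ℂ) ∧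
      ∀ n : ℕ, n ≤ 2 → ∀ z, ‖iteratedFDeriv ℝ n (𝓕 h : Plane → ℂ) z‖
        ≤ (1 + 2 * Real.pi) ^ 2 * M := by
  have hi' : ∀ n : ℕ, (n : ℕ∞) ≤ (2 : ℕ∞) → Integrable (fun ξ ↦ ‖ξ‖ ^ n * ‖h ξ‖) :=
    fun n hn ↦ hi n (by exact_mod_cast hn)
  refine ⟨Real.contDiff_fourier (N := 2) hi', fun n hn z ↦ ?_⟩
  rw [Real.iteratedFDeriv_fourier (N := 2) hi' hm (by exact_mod_cast hn)]
  have h1 : ‖𝓕 (fun v ↦ VectorFourier.fourierPowSMulRight (innerSL ℝ) h v n) z‖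
      ≤ ∫ ξ, ‖VectorFourier.fourierPowSMulRight (innerSL ℝ) h ξ n‖ :=
    VectorFourier.norm_fourierIntegral_le_integral_norm _ _ _ _ _
  have hM0 : 0 ≤ M := le_trans (integral_nonneg fun ξ ↦ by positivity) (hM n hn)
  have hpi : 0 < Real.pi := Real.pi_pos
  have h2 : ∀ ξ, ‖VectorFourier.fourierPowSMulRight (innerSL ℝ) h ξ n‖
      ≤ (1 + 2 * Real.pi) ^ 2 * (‖ξ‖ ^ n * ‖h ξ‖) := fun ξ ↦ by
    refine (VectorFourier.norm_fourierPowSMulRight_le (innerSL ℝ) h ξ n).trans ?_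
    rw [mul_assoc]
    refine mul_le_mul_of_nonneg_right ?_ (by positivity)
    have : ‖innerSL ℝ (E := Plane)‖ ≤ 1 := norm_innerSL_le ℝ
    -- The base 1 + 2π is at least 1, so a single constant serves every n ≤ 2.
    calc (2 * Real.pi * ‖innerSL ℝ (E := Plane)‖) ^ n ≤ (1 + 2 * Real.pi) ^ n := by
          gcongr
          nlinarith
      _ ≤ (1 + 2 * Real.pi) ^ 2 := pow_le_pow_right₀ (by linarith) hn
  refine h1.trans ((integral_mono_of_nonneg (Filter.Eventually.of_forall fun _ ↦ norm_nonneg _)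
    ((hi n hn).const_mul _) (Filter.Eventually.of_forall h2)).trans ?_)
  rw [integral_const_mul]
  exact mul_le_mul_of_nonneg_left (hM n hn) (by positivity)

/-- The weight `(1 + |ξ|²)^{-3/4}` is square integrable on the plane. -/
theorem memLp_weight :
    MemLp (fun ξ : Plane ↦ (1 + ‖ξ‖ ^ 2) ^ (-3 / 4 : ℝ)) 2 := by
  have hc : Continuous (fun ξ : Plane ↦ (1 + ‖ξ‖ ^ 2) ^ (-3 / 4 : ℝ)) := by
    refine Continuous.rpow_const (by fun_prop) fun ξ ↦ Or.inl (by positivity)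
  rw [memLp_two_iff_integrable_sq hc.aestronglyMeasurable]
  have := integrable_rpow_neg_one_add_norm_sq (E := Plane) (μ := volume) (r := 3)
    (by simp; norm_num)
  refine this.congr (Filter.Eventually.of_forall fun ξ ↦ ?_)
  simp only
  rw [← Real.rpow_mul_natCast (by positivity)]
  norm_num

/-- Two derivatives cost at most 1 + |ξ|², and -7/4 + 1 = -3/4: the remaining weight is still square
integrable in dimension two. -/
theorem weight_le {n : ℕ} (hn : n ≤ 2) (ξ : Plane) :
    ‖ξ‖ ^ n * (1 + ‖ξ‖ ^ 2) ^ (-(7 / 2) / 2 : ℝ) ≤ (1 + ‖ξ‖ ^ 2) ^ (-3 / 4 : ℝ) := by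
  have h1 : ‖ξ‖ ^ n ≤ 1 + ‖ξ‖ ^ 2 := by
    have := norm_nonneg ξ
    interval_cases n
    · nlinarith
    · nlinarith [sq_nonneg (‖ξ‖ - 1)]
    · linarith
  calc ‖ξ‖ ^ n * (1 + ‖ξ‖ ^ 2) ^ (-(7 / 2) / 2 : ℝ)
      ≤ (1 + ‖ξ‖ ^ 2) * (1 + ‖ξ‖ ^ 2) ^ (-(7 / 2) / 2 : ℝ) := by gcongr
    _ = (1 + ‖ξ‖ ^ 2) ^ (1 : ℝ) * (1 + ‖ξ‖ ^ 2) ^ (-(7 / 2) / 2 : ℝ) := by rw [Real.rpow_one]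
    _ = _ := by
      rw [← Real.rpow_add (by positivity)]
      norm_num

theorem integral_norm_mul_le {θ : Plane → ℝ} (hθ : MemLp θ 2) (u : Lp ℂ 2 (volume : Measure Plane)) :
    Integrable (fun ξ ↦ ‖θ ξ‖ * ‖u ξ‖) ∧
      ∫ ξ, ‖θ ξ‖ * ‖u ξ‖ ≤ (eLpNorm θ 2 volume).toReal * ‖u‖ := by
  have hu : MemLp (fun ξ ↦ ‖u ξ‖) 2 := (Lp.memLp u).norm
  have hθ' : MemLp (fun ξ ↦ ‖θ ξ‖) 2 := hθ.norm
  refine ⟨hθ'.integrable_mul hu, ?_⟩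
  have h := integral_mul_norm_le_Lp_mul_Lq (μ := volume) (f := fun ξ ↦ ‖θ ξ‖)
    (g := fun ξ ↦ ‖u ξ‖) (p := 2) (q := 2)
    Real.HolderConjugate.two_two (by simpa using hθ') (by simpa using hu)
  simp only [norm_norm] at h
  refine h.trans (le_of_eq ?_)
  rw [Lp.norm_def, hθ.eLpNorm_eq_integral_rpow_norm two_ne_zero ENNReal.ofNat_ne_top,
    (Lp.memLp u).eLpNorm_eq_integral_rpow_norm two_ne_zero ENNReal.ofNat_ne_top,
    ENNReal.toReal_ofReal (by positivity), ENNReal.toReal_ofReal (by positivity)]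
  simp

open FourierTransform in
/-- The Sobolev embedding `H^{7/2}(ℝ²) ⊂ C²(ℝ²)`. -/
theorem exists_contDiff_two_of_besselPotential_eq :
    ∃ K : ℝ, 0 < K ∧ ∀ (f : 𝓢'(Plane, ℂ)) (g : Lp ℂ 2 (volume : Measure Plane)),
      besselPotential Plane ℂ (7 / 2) f = (g : 𝓢'(Plane, ℂ)) →
      ∃ F : Plane → ℂ, ContDiff ℝ 2 F ∧ (∀ η : 𝓢(Plane, ℂ), f η = ∫ z, η z * F z) ∧
        ∀ n : ℕ, n ≤ 2 → ∀ z, ‖iteratedFDeriv ℝ n F z‖ ≤ K * ‖g‖ := by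
  set w : Plane → ℝ := fun ξ ↦ (1 + ‖ξ‖ ^ 2) ^ (-3 / 4 : ℝ) with hw
  set N : ℝ := (eLpNorm w 2 volume).toReal with hN
  have hpi := Real.pi_pos
  refine ⟨(1 + 2 * Real.pi) ^ 2 * (N + 1), by positivity, fun f g hfg ↦ ?_⟩
  set u : Lp ℂ 2 (volume : Measure Plane) := 𝓕 g with hu
  set m : Plane → ℂ := fun ξ ↦ ((1 + ‖ξ‖ ^ 2) ^ (-(7 / 2) / 2 : ℝ) : ℝ) with hm
  have hmt : m.HasTemperateGrowth := by fun_prop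
  set h : Plane → ℂ := fun ξ ↦ m ξ * u ξ with hh
  have hnorm : ∀ ξ, ‖m ξ‖ = (1 + ‖ξ‖ ^ 2) ^ (-(7 / 2) / 2 : ℝ) := fun ξ ↦ by
    simp only [hm, Complex.norm_real, Real.norm_eq_abs]
    exact abs_of_nonneg (by positivity)
  have hhm : AEStronglyMeasurable h volume :=
    hmt.1.continuous.aestronglyMeasurable.mul (Lp.aestronglyMeasurable u)
  obtain ⟨hI, hle⟩ := integral_norm_mul_le memLp_weight u
  have hbd : ∀ n : ℕ, n ≤ 2 → ∀ ξ, ‖ξ‖ ^ n * ‖h ξ‖ ≤ ‖w ξ‖ * ‖u ξ‖ := fun n hn ξ ↦ by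
    rw [hh, norm_mul, ← mul_assoc, hnorm]
    gcongr
    exact (weight_le hn ξ).trans (le_abs_self _)
  have hi : ∀ n : ℕ, n ≤ 2 → Integrable (fun ξ ↦ ‖ξ‖ ^ n * ‖h ξ‖) := fun n hn ↦ by
    refine hI.mono ?_ (Filter.Eventually.of_forall fun ξ ↦ ?_)
    · exact (by fun_prop : Continuous fun ξ : Plane ↦ ‖ξ‖ ^ n).aestronglyMeasurable.mul hhm.norm
    · rw [Real.norm_of_nonneg (by positivity), Real.norm_of_nonneg (by positivity)]
      exact hbd n hn ξ
  have hgu : ‖u‖ = ‖g‖ := Lp.norm_fourier_eq g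
  have hMle : ∀ n : ℕ, n ≤ 2 → ∫ ξ, ‖ξ‖ ^ n * ‖h ξ‖ ≤ (N + 1) * ‖g‖ := fun n hn ↦ by
    refine (integral_mono (hi n hn) hI (hbd n hn)).trans (hle.trans ?_)
    rw [hgu]
    gcongr
    change N ≤ N + 1
    linarith
  have hhi : Integrable h := by
    have := hi 0 (by norm_num)
    simp only [pow_zero, one_mul] at this
    exact (integrable_norm_iff hhm).1 this
  -- The representative is 𝓕⁻ h, treated as the forward transform of the reflection of h.
  have key := contDiff_two_fourier (h := fun ξ ↦ h (-ξ)) (M := (N + 1) * ‖g‖)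
    (hhm.comp_quasiMeasurePreserving (Measure.measurePreserving_neg volume).quasiMeasurePreserving)
    (fun n hn ↦ by simpa using (hi n hn).comp_neg)
    (fun n hn ↦ by
      refine le_of_eq_of_le ?_ (hMle n hn)
      simpa using integral_neg_eq_self (fun ξ ↦ ‖ξ‖ ^ n * ‖h ξ‖) volume)
  rw [← Real.fourierInv_eq_fourier_comp_neg] at key
  refine ⟨𝓕⁻ h, key.1, fun η ↦ ?_, fun n hn z ↦ (key.2 n hn z).trans (le_of_eq (by ring))⟩
  have hFf : 𝓕 f = smulLeftCLM ℂ m (u : 𝓢'(Plane, ℂ)) := by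
    have h1 := congrArg (fun T : 𝓢'(Plane, ℂ) ↦ 𝓕 T) hfg
    simp only [fourier_besselPotential_eq_smulLeftCLM_fourier_apply,
      Lp.fourier_toTemperedDistribution_eq] at h1
    rw [hu, ← h1, smulLeftCLM_smulLeftCLM_apply (by fun_prop) (by fun_prop)]
    have : ((fun x : Plane ↦ (((1 + ‖x‖ ^ 2) ^ ((7 / 2 : ℝ) / 2) : ℝ) : ℂ)) * m)
        = fun _ ↦ (1 : ℂ) := by
      ext ξ
      simp only [hm, Pi.mul_apply]
      norm_cast
      rw [← Real.rpow_add (by positivity)]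
      norm_num
    rw [this, smulLeftCLM_const, one_smul]
  have h2 : f η = (𝓕 f) (𝓕⁻ η) := by
    rw [TemperedDistribution.fourier_apply, FourierTransform.fourier_fourierInv_eq]
  rw [h2, hFf, TemperedDistribution.smulLeftCLM_apply_apply, Lp.toTemperedDistribution_apply]
  have h3 : ∀ ξ, (SchwartzMap.smulLeftCLM ℂ m (𝓕⁻ η)) ξ • u ξ = (𝓕⁻ (η : Plane → ℂ)) ξ • h ξ := by
    intro ξ
    rw [SchwartzMap.smulLeftCLM_apply_apply hmt, hh, SchwartzMap.fourierInv_coe]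
    simp only [smul_eq_mul]
    ring
  simp_rw [h3]
  -- With the pairing -⟨·,·⟩ the vector Fourier integral is 𝓕⁻; the pairing is symmetric, so 𝓕⁻
  -- moves from η to h.
  have h4 := VectorFourier.integral_fourierIntegral_smul_eq_flip (L := -innerₗ Plane)
    (μ := volume) (ν := volume) (e := Real.fourierChar) (f := η) (g := h)
    Real.continuous_fourierChar (by simp; fun_prop) η.integrable hhi
  have h5 : ((-innerₗ Plane).flip : Plane →ₗ[ℝ] Plane →ₗ[ℝ] ℝ) = -innerₗ Plane := by
    ext x y
    simp [real_inner_comm]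
  rw [h5] at h4
  have h6 : ∀ θ : Plane → ℂ, 𝓕⁻ θ
      = VectorFourier.fourierIntegral Real.fourierChar volume (-innerₗ Plane) θ := by
    intro θ
    ext z
    rw [Real.fourierInv_eq, VectorFourier.fourierIntegral]
    simp
  rw [h6, h6]
  exact h4

/-- A bound for the `H^{7/2}` norm yields a `C²` representative with the same bound. -/
theorem exists_contDiff_two_of_sobolevNorm_le :
    ∃ K : ℝ, 0 < K ∧ ∀ (f : 𝓢'(Plane, ℂ)) (B : ℝ), 0 < B →
      sobolevNorm (7 / 2) f ≤ ENNReal.ofReal B →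
      ∃ F : Plane → ℂ, ContDiff ℝ 2 F ∧ (∀ η : 𝓢(Plane, ℂ), f η = ∫ z, η z * F z) ∧
        ∀ n : ℕ, n ≤ 2 → ∀ z, ‖iteratedFDeriv ℝ n F z‖ ≤ K * B := by
  obtain ⟨K, hK, h⟩ := exists_contDiff_two_of_besselPotential_eq
  refine ⟨K * 2, by positivity, fun f B hB hf ↦ ?_⟩
  -- Doubling the bound makes the inequality strict, and a strict bound on the infimum yields an
  -- actual g; this needs B > 0.
  have hlt : sobolevNorm (7 / 2) f < ENNReal.ofReal (2 * B) :=
    hf.trans_lt ((ENNReal.ofReal_lt_ofReal_iff (by positivity)).2 (by linarith))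
  simp only [sobolevNorm, iInf_lt_iff] at hlt
  obtain ⟨g, hg, hgB⟩ := hlt
  obtain ⟨F, hF, hFη, hFb⟩ := h f g hg
  refine ⟨F, hF, hFη, fun n hn z ↦ (hFb n hn z).trans ?_⟩
  have : ‖g‖ ≤ 2 * B := by
    rw [← ofReal_norm, ENNReal.ofReal_lt_ofReal_iff (by positivity)] at hgB
    exact hgB.le
  calc K * ‖g‖ ≤ K * (2 * B) := by gcongr
    _ = K * 2 * B := by ring

end KdVSystem

/-! ### Test functions on an open set and uniqueness of representatives. -/

namespace KdVSystem

open LineDeriv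

theorem isOpen_square (x₀ t₀ ε : ℝ) : IsOpen (square x₀ t₀ ε) :=
  (isOpen_Ioo.preimage (by fun_prop : Continuous fun z : Plane ↦ z 0)).inter
    (isOpen_Ioo.preimage (by fun_prop : Continuous fun z : Plane ↦ z 1))

section Test

variable {U : Set Plane} {η : 𝓢(Plane, ℂ)}

theorem IsTestOn.lineDeriv (hη : IsTestOn U η) (e : Plane) : IsTestOn U (∂_{e} η) := by
  have h : tsupport (∂_{e} η : 𝓢(Plane, ℂ)) ⊆ tsupport η :=
    SchwartzMap.tsupport_lineDerivOp_subset e η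
  exact ⟨hη.1.of_isClosed_subset (isClosed_tsupport _) h, h.trans hη.2⟩

theorem IsTestOn.smulLeft (hη : IsTestOn U η) (g : Plane → ℂ) :
    IsTestOn U (SchwartzMap.smulLeftCLM ℂ g η) := by
  have h : tsupport (SchwartzMap.smulLeftCLM ℂ g η) ⊆ tsupport η :=
    (SchwartzMap.tsupport_smulLeftCLM_subset g η).trans Set.inter_subset_left
  exact ⟨hη.1.of_isClosed_subset (isClosed_tsupport _) h, h.trans hη.2⟩

theorem IsTestOn.integrable_mul (hη : IsTestOn U η) {G : Plane → ℂ}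
    (hG : LocallyIntegrableOn G U) : Integrable (fun z ↦ η z * G z) := by
  have h1 : IntegrableOn G (tsupport η) := hG.integrableOn_compact_subset hη.2 hη.1
  have h2 : IntegrableOn (fun z ↦ η z * G z) (tsupport η) :=
    h1.continuousOn_mul η.continuous.continuousOn hη.1
  refine (integrableOn_iff_integrable_of_support_subset fun z hz ↦ ?_).1 h2
  exact subset_tsupport _ (left_ne_zero_of_mul (Function.mem_support.1 hz))

theorem IsTestOn.integral_lineDeriv_mul (hη : IsTestOn U η) (hU : IsOpen U) {G G' : Plane → ℂ}
    {e : Plane} (hG : ContinuousOn G U) (hG' : ContinuousOn G' U)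
    (hd : ∀ z ∈ U, HasLineDerivAt ℝ G (G' z) z e) :
    ∫ z, (∂_{e} η) z * G z = -∫ z, η z * G' z := by
  have h := integral_bilinear_hasLineDerivAt_right_eq_neg_left_of_integrable (μ := volume)
    (f := (η : Plane → ℂ)) (f' := fun z ↦ (∂_{e} η) z) (g := G) (g' := G') (v := e)
    (B := ContinuousLinearMap.mul ℝ ℂ)
    ((hη.lineDeriv e).integrable_mul (hG.locallyIntegrableOn hU.measurableSet))
    (hη.integrable_mul (hG'.locallyIntegrableOn hU.measurableSet))
    (hη.integrable_mul (hG.locallyIntegrableOn hU.measurableSet))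
    (fun z _ ↦ η.differentiableAt.hasFDerivAt.hasLineDerivAt e) (fun z hz ↦ hd z (hη.2 hz))
  simp only [ContinuousLinearMap.mul_apply'] at h
  rw [h, neg_neg]

/-- Real smooth bumps already separate locally integrable functions, and each one is a complex
Schwartz test function. -/
theorem ae_eq_of_forall_isTestOn (hU : IsOpen U) {f g : Plane → ℂ}
    (hf : LocallyIntegrableOn f U) (hg : LocallyIntegrableOn g U)
    (h : ∀ η : 𝓢(Plane, ℂ), IsTestOn U η → ∫ z, η z * f z = ∫ z, η z * g z) :
    ∀ᵐ z, z ∈ U → f z = g z := by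
  have := hU.ae_eq_zero_of_integral_contDiff_smul_eq_zero (μ := volume) (hf.sub hg) ?_
  · filter_upwards [this] with z hz hzU
    exact sub_eq_zero.1 (hz hzU)
  · intro θ hθ hθc hθU
    have hc : HasCompactSupport (fun z ↦ ((θ z : ℝ) : ℂ)) :=
      hθc.comp_left (g := fun r : ℝ ↦ (r : ℂ)) Complex.ofReal_zero
    have ht : tsupport (fun z ↦ ((θ z : ℝ) : ℂ)) ⊆ tsupport θ :=
      closure_mono fun z hz ↦ by simpa using hz
    set η : 𝓢(Plane, ℂ) := hc.toSchwartzMap (Complex.ofRealCLM.contDiff.comp hθ) with hηd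
    have hη : IsTestOn U η := ⟨hc, ht.trans hθU⟩
    have h1 : ∀ z, θ z • (f - g) z = η z * f z - η z * g z := fun z ↦ by
      change (θ z : ℝ) • (f z - g z) = (θ z : ℂ) * f z - (θ z : ℂ) * g z
      rw [Complex.real_smul, mul_sub]
    simp_rw [h1]
    rw [integral_sub (hη.integrable_mul hf) (hη.integrable_mul hg), h η hη, sub_self]

theorem eqOn_of_forall_isTestOn (hU : IsOpen U) {f g : Plane → ℂ}
    (hf : ContinuousOn f U) (hg : ContinuousOn g U)
    (h : ∀ η : 𝓢(Plane, ℂ), IsTestOn U η → ∫ z, η z * f z = ∫ z, η z * g z) :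
    Set.EqOn f g U := by
  have h1 := ae_eq_of_forall_isTestOn hU (hf.locallyIntegrableOn hU.measurableSet)
    (hg.locallyIntegrableOn hU.measurableSet) h
  exact Measure.eqOn_open_of_ae_eq ((ae_restrict_iff' hU.measurableSet).2 h1) hU hf hg

end Test

/-! ### Transposes of P and ∂ₜ + ∂ₓ³, and their commutators. -/

section Schwartz

theorem hasTemperateGrowth_coord (i : Fin 2) :
    Function.HasTemperateGrowth (fun z : Plane ↦ ((z i : ℝ) : ℂ)) :=
  (Complex.ofRealCLM.comp (EuclideanSpace.proj i : Plane →L[ℝ] ℝ)).hasTemperateGrowth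

/-- Multiplication of a Schwartz function by a coordinate. -/
noncomputable def mulCoord (i : Fin 2) : 𝓢(Plane, ℂ) →L[ℂ] 𝓢(Plane, ℂ) :=
  SchwartzMap.smulLeftCLM ℂ (fun z : Plane ↦ ((z i : ℝ) : ℂ))

theorem mulCoord_apply (i : Fin 2) (η : 𝓢(Plane, ℂ)) (z : Plane) :
    mulCoord i η z = ((z i : ℝ) : ℂ) * η z := by
  rw [mulCoord, SchwartzMap.smulLeftCLM_apply_apply (hasTemperateGrowth_coord i), smul_eq_mul]

theorem lineDeriv_mulCoord (i : Fin 2) (e : Plane) (η : 𝓢(Plane, ℂ)) :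
    ∂_{e} (mulCoord i η) = ((e i : ℝ) : ℂ) • η + mulCoord i (∂_{e} η) := by
  ext z
  have h1 : HasFDerivAt (fun z : Plane ↦ ((z i : ℝ) : ℂ))
      (Complex.ofRealCLM.comp (EuclideanSpace.proj i : Plane →L[ℝ] ℝ)) z :=
    (Complex.ofRealCLM.comp (EuclideanSpace.proj i : Plane →L[ℝ] ℝ)).hasFDerivAt
  have h2 : HasFDerivAt η (fderiv ℝ η z) z := η.differentiableAt.hasFDerivAt
  have h3 : (mulCoord i η : Plane → ℂ) = fun z ↦ ((z i : ℝ) : ℂ) * η z :=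
    funext (mulCoord_apply i η)
  rw [SchwartzMap.lineDerivOp_apply_eq_fderiv, h3,
    show (fun z ↦ ((z i : ℝ) : ℂ) * η z) = (fun z : Plane ↦ ((z i : ℝ) : ℂ)) * η from rfl,
    (h1.mul h2).fderiv, add_apply, add_apply,
    mulCoord_apply, SchwartzMap.lineDerivOp_apply_eq_fderiv]
  simp
  ring

theorem lineDeriv_comm (a b : Plane) (η : 𝓢(Plane, ℂ)) :
    (∂_{a} (∂_{b} η) : 𝓢(Plane, ℂ)) = ∂_{b} (∂_{a} η) := by
  ext z
  have hd : DifferentiableAt ℝ (fderiv ℝ η) z :=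
    ((η.smooth 2).fderiv_right (m := 1) (by norm_num)).differentiable one_ne_zero z
  have h : ∀ a b : Plane, (∂_{a} (∂_{b} η) : 𝓢(Plane, ℂ)) z = fderiv ℝ (fderiv ℝ η) z a b := by
    intro a b
    rw [SchwartzMap.lineDerivOp_apply_eq_fderiv]
    have : ((∂_{b} η : 𝓢(Plane, ℂ)) : Plane → ℂ) = fun y ↦ fderiv ℝ η y b := rfl
    rw [this, fderiv_clm_apply hd (by fun_prop)]
    simp
  rw [h, h]
  exact ((η.smooth 2).contDiffAt.isSymmSndFDerivAt (by simp)) a b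

/-- The negative transpose of `P`, acting on Schwartz functions. -/
noncomputable def dualP (η : 𝓢(Plane, ℂ)) : 𝓢(Plane, ℂ) :=
  (3 : ℂ) • ∂_{et} (mulCoord 1 η) + ∂_{ex} (mulCoord 0 η)

/-- The transpose of `∂ₜ + ∂ₓ³`, acting on Schwartz functions. -/
noncomputable def dualL (η : 𝓢(Plane, ℂ)) : 𝓢(Plane, ℂ) :=
  -(∂_{et} η) - ∂_{ex} (∂_{ex} (∂_{ex} η))

theorem P_apply (w : 𝓢'(Plane, ℂ)) (η : 𝓢(Plane, ℂ)) : P w η = -w (dualP η) := by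
  have h : P w η = 3 * w (-∂_{et} (mulCoord 1 η)) + w (-∂_{ex} (mulCoord 0 η)) := rfl
  rw [h, dualP, map_neg, map_neg, map_add, map_smul, smul_eq_mul]
  ring

theorem airy_apply (w : 𝓢'(Plane, ℂ)) (η : 𝓢(Plane, ℂ)) :
    (∂_{et} w + dxPow 3 w) η = w (dualL η) := by
  have h : (∂_{et} w + dxPow 3 w) η = w (-∂_{et} η) + w (-∂_{ex} (-∂_{ex} (-∂_{ex} η))) := rfl
  rw [h, dualL, sub_eq_add_neg, map_add]
  simp [lineDerivOp_neg]

@[simp] theorem ex_zero : ex 0 = 1 := by simp [ex]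
@[simp] theorem ex_one : ex 1 = 0 := by simp [ex]
@[simp] theorem et_zero : et 0 = 0 := by simp [et]
@[simp] theorem et_one : et 1 = 1 := by simp [et]

/-- The 4 is the divergence 3 + 1 of the dilation field. -/
theorem dualP_eq (η : 𝓢(Plane, ℂ)) :
    dualP η = (4 : ℂ) • η + (3 : ℂ) • mulCoord 1 (∂_{et} η) + mulCoord 0 (∂_{ex} η) := by
  rw [dualP, lineDeriv_mulCoord, lineDeriv_mulCoord]
  simp only [et_one, ex_zero]
  push_cast
  module

theorem lineDeriv_ex_dualP (η : 𝓢(Plane, ℂ)) :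
    ∂_{ex} (dualP η) = dualP (∂_{ex} η) + ∂_{ex} η := by
  rw [dualP_eq, dualP_eq, lineDerivOp_add, lineDerivOp_add, lineDerivOp_smul, lineDerivOp_smul,
    lineDeriv_mulCoord, lineDeriv_mulCoord, lineDeriv_comm ex et]
  simp only [ex_one, ex_zero]
  push_cast
  module

theorem lineDeriv_et_dualP (η : 𝓢(Plane, ℂ)) :
    ∂_{et} (dualP η) = dualP (∂_{et} η) + (3 : ℂ) • ∂_{et} η := by
  rw [dualP_eq, dualP_eq, lineDerivOp_add, lineDerivOp_add, lineDerivOp_smul, lineDerivOp_smul,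
    lineDeriv_mulCoord, lineDeriv_mulCoord, lineDeriv_comm et ex]
  simp only [et_one, et_zero]
  push_cast
  module

theorem dualP_add (η θ : 𝓢(Plane, ℂ)) : dualP (η + θ) = dualP η + dualP θ := by
  simp only [dualP_eq, lineDerivOp_add, map_add, smul_add]
  abel

theorem dualP_neg (η : 𝓢(Plane, ℂ)) : dualP (-η) = -dualP η := by
  simp only [dualP_eq, lineDerivOp_neg, map_neg, smul_neg]
  abel

/-- Under (x, t) ↦ (λx, λ³t) both ∂ₜ and ∂ₓ³ have weight 3, so the whole operator has one commutator
constant. This is the transpose of LP = (P + 3)L. -/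
theorem dualL_dualP (η : 𝓢(Plane, ℂ)) :
    dualL (dualP η) = dualP (dualL η) + (3 : ℂ) • dualL η := by
  simp only [dualL, lineDeriv_ex_dualP, lineDeriv_et_dualP, lineDerivOp_add, sub_eq_add_neg,
    dualP_add, dualP_neg]
  module

variable {U : Set Plane} {η : 𝓢(Plane, ℂ)}

theorem IsTestOn.mulCoord (hη : IsTestOn U η) (i : Fin 2) : IsTestOn U (mulCoord i η) :=
  hη.smulLeft _

theorem isTestOn_of_tsupport_subset {θ : 𝓢(Plane, ℂ)} (hη : IsTestOn U η)
    (h : ∀ z, z ∉ tsupport η → θ z = 0) : IsTestOn U θ := by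
  have h1 : tsupport θ ⊆ tsupport η :=
    closure_minimal (fun z hz ↦ by_contra fun hn ↦ hz (h z hn)) (isClosed_tsupport _)
  exact ⟨hη.1.of_isClosed_subset (isClosed_tsupport _) h1, h1.trans hη.2⟩

theorem IsTestOn.dualP (hη : IsTestOn U η) : IsTestOn U (dualP η) := by
  refine isTestOn_of_tsupport_subset hη fun z hz ↦ ?_
  have h0 : η z = 0 := image_eq_zero_of_notMem_tsupport hz
  have h1 : ∀ e : Plane, (∂_{e} η : 𝓢(Plane, ℂ)) z = 0 := fun e ↦
    image_eq_zero_of_notMem_tsupport fun h ↦ hz (SchwartzMap.tsupport_lineDerivOp_subset e η h)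
  rw [dualP_eq]
  simp [mulCoord_apply, h0, h1]

/-- The vector field `3 t ∂ₜ + x ∂ₓ` acting on differentiable functions. -/
noncomputable def dilation (G : Plane → ℂ) (z : Plane) : ℂ :=
  3 * ((z 1 : ℝ) : ℂ) * fderiv ℝ G z et + ((z 0 : ℝ) : ℂ) * fderiv ℝ G z ex

theorem continuous_coord (i : Fin 2) : Continuous (fun z : Plane ↦ ((z i : ℝ) : ℂ)) := by
  fun_prop

theorem _root_.ContDiff.continuous_fderiv_dir {G : Plane → ℂ} (hG : ContDiff ℝ 1 G) (e : Plane) :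
    Continuous fun z ↦ fderiv ℝ G z e :=
  (hG.continuous_fderiv one_ne_zero).clm_apply continuous_const

theorem continuous_dilation {G : Plane → ℂ} (hG : ContDiff ℝ 1 G) : Continuous (dilation G) :=
  ((continuous_const.mul (continuous_coord 1)).mul (hG.continuous_fderiv_dir et)).add
    ((continuous_coord 0).mul (hG.continuous_fderiv_dir ex))

theorem IsTestOn.integral_fderiv (hη : IsTestOn U η) (hU : IsOpen U) {G : Plane → ℂ}
    (hG : ContDiff ℝ 1 G) (e : Plane) :
    ∫ z, (∂_{e} η) z * G z = -∫ z, η z * fderiv ℝ G z e :=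
  hη.integral_lineDeriv_mul hU hG.continuous.continuousOn (hG.continuous_fderiv_dir e).continuousOn
    fun z _ ↦ (hG.differentiable one_ne_zero z).hasFDerivAt.hasLineDerivAt e

theorem IsTestOn.integrable_mul_of_continuous (hη : IsTestOn U η) {G : Plane → ℂ}
    (hG : Continuous G) : Integrable (fun z ↦ η z * G z) :=
  hη.integrable_mul (hG.locallyIntegrable.locallyIntegrableOn U)

theorem IsTestOn.integral_dualP (hη : IsTestOn U η) (hU : IsOpen U) {G : Plane → ℂ}
    (hG : ContDiff ℝ 1 G) :
    ∫ z, (KdVSystem.dualP η) z * G z = -∫ z, η z * dilation G z := by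
  have h1 := ((hη.mulCoord 1).lineDeriv et).integrable_mul_of_continuous hG.continuous
  have h2 := ((hη.mulCoord 0).lineDeriv ex).integrable_mul_of_continuous hG.continuous
  have h3 : ∀ z, (KdVSystem.dualP η) z * G z
      = 3 * ((∂_{et} (KdVSystem.mulCoord 1 η)) z * G z)
        + (∂_{ex} (KdVSystem.mulCoord 0 η)) z * G z := fun z ↦ by
    rw [KdVSystem.dualP, add_apply, smul_apply, smul_eq_mul]
    ring
  simp_rw [h3]
  rw [integral_add (h1.const_mul 3) h2, integral_const_mul, (hη.mulCoord 1).integral_fderiv hU hG,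
    (hη.mulCoord 0).integral_fderiv hU hG]
  have h4 := (hη.mulCoord 1).integrable_mul_of_continuous (hG.continuous_fderiv_dir et)
  have h5 := (hη.mulCoord 0).integrable_mul_of_continuous (hG.continuous_fderiv_dir ex)
  have h6 : ∀ z, η z * dilation G z = 3 * (KdVSystem.mulCoord 1 η z * fderiv ℝ G z et)
      + KdVSystem.mulCoord 0 η z * fderiv ℝ G z ex := fun z ↦ by
    rw [mulCoord_apply, mulCoord_apply, dilation]
    ring
  simp_rw [h6]
  rw [integral_add (h4.const_mul 3) h5, integral_const_mul]
  ring

end Schwartz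

/-! ### P and the equation in weak form. -/

section Weak

variable {U : Set Plane}

/-- `P` acts on distributions given by `C¹` functions as the vector field does. -/
theorem eqOn_dilation (hU : IsOpen U) {w : 𝓢'(Plane, ℂ)} {G H : Plane → ℂ} (hG : ContDiff ℝ 1 G)
    (hH : Continuous H) (hw : ∀ η, IsTestOn U η → w η = ∫ z, η z * G z)
    (hPw : ∀ η, IsTestOn U η → P w η = ∫ z, η z * H z) : Set.EqOn H (dilation G) U := by
  refine eqOn_of_forall_isTestOn hU hH.continuousOn (continuous_dilation hG).continuousOn
    fun η hη ↦ ?_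
  rw [← hPw η hη, P_apply, hw _ hη.dualP, hη.integral_dualP hU hG, neg_neg]

/-- Applying `P` to the weak form of `wₜ + wₓₓₓ + Mₓ = 0` replaces `M` by `(P + 2) M`. -/
theorem airy_P_apply (hU : IsOpen U) {w : 𝓢'(Plane, ℂ)} {M : Plane → ℂ} (hM : ContDiff ℝ 1 M)
    (hw : ∀ η, IsTestOn U η → (∂_{et} w + dxPow 3 w) η = ∫ z, (∂_{ex} η) z * M z)
    {η : 𝓢(Plane, ℂ)} (hη : IsTestOn U η) :
    (∂_{et} (P w) + dxPow 3 (P w)) η = ∫ z, (∂_{ex} η) z * (dilation M z + 2 * M z) := by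
  have hx := hη.lineDeriv ex
  have h1 := hw _ hη.dualP
  have h2 := hw _ hη
  rw [airy_apply] at h1 h2 ⊢
  rw [P_apply]
  -- The 2 in P + 2 is 3 - 1: commuting P past ∂ₜ + ∂ₓ³ yields 3, and commuting it past the ∂ₓ in
  -- front of the flux takes back 1.
  rw [dualL_dualP, map_add, map_smul, h2, lineDeriv_ex_dualP, smul_eq_mul] at h1
  have h3 : ∀ z, (dualP (∂_{ex} η) + ∂_{ex} η) z * M z
      = dualP (∂_{ex} η) z * M z + (∂_{ex} η) z * M z := fun z ↦ by
    rw [add_apply, add_mul]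
  simp_rw [h3] at h1
  rw [integral_add (hx.dualP.integrable_mul_of_continuous hM.continuous)
    (hx.integrable_mul_of_continuous hM.continuous), hx.integral_dualP hU hM] at h1
  simp_rw [mul_add]
  rw [integral_add (hx.integrable_mul_of_continuous (continuous_dilation hM))
    (hx.integrable_mul_of_continuous (by fun_prop))]
  simp_rw [mul_left_comm _ (2 : ℂ)]
  rw [integral_const_mul]
  linear_combination -h1

theorem cutoff_apply {ψ : Plane → ℝ} (hψ : ContDiff ℝ ∞ ψ) (hψc : HasCompactSupport ψ)
    (hψ1 : ∀ z ∈ U, ψ z = 1) (w : 𝓢'(Plane, ℂ)) {η : 𝓢(Plane, ℂ)} (hη : IsTestOn U η) :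
    cutoff ψ w η = w η := by
  rw [cutoff, TemperedDistribution.smulLeftCLM_apply_apply]
  congr 1
  ext z
  have hg : Function.HasTemperateGrowth (fun z ↦ ((ψ z : ℝ) : ℂ)) := by
    have hc : HasCompactSupport (fun z ↦ ((ψ z : ℝ) : ℂ)) :=
      hψc.comp_left (g := fun r : ℝ ↦ (r : ℂ)) Complex.ofReal_zero
    exact (hc.toSchwartzMap (Complex.ofRealCLM.contDiff.comp hψ)).hasTemperateGrowth
  rw [SchwartzMap.smulLeftCLM_apply_apply hg, smul_eq_mul]
  by_cases hz : z ∈ tsupport η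
  · rw [hψ1 z (hη.2 hz)]
    simp
  · rw [image_eq_zero_of_notMem_tsupport hz, mul_zero]

end Weak

end KdVSystem

/-! ### From weak to classical directional derivatives by mollification. -/

namespace KdVSystem

open Filter Topology Convolution

theorem hasLineDerivAt_add_smul_iff {G : Plane → ℂ} {c : ℂ} {z e : Plane} {s : ℝ} :
    HasLineDerivAt ℝ G c (z + s • e) e ↔ HasDerivAt (fun r : ℝ ↦ G (z + r • e)) c s := by
  have h : (fun r : ℝ ↦ G (z + s • e + r • e)) = fun r ↦ (fun r : ℝ ↦ G (z + r • e)) (s + r) := by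
    ext r
    congr 1
    module
  rw [HasLineDerivAt, h]
  constructor
  · intro h1
    have h2 : HasDerivAt (fun r : ℝ ↦ (fun r : ℝ ↦ G (z + r • e)) (s + r)) c (-s + s) := by
      simpa using h1
    simpa using h2.comp_const_add (-s) s
  · intro h1
    exact HasDerivAt.comp_const_add s 0 (by simpa using h1)

/-- A limit of functions whose directional derivatives converge continuously is differentiable. -/
theorem hasLineDerivAt_of_tendsto {ι : Type*} {l : Filter ι} [l.NeBot] {G H : Plane → ℂ}
    {Gn Hn : ι → Plane → ℂ} {z e : Plane} {S : Set Plane} (hS : S ∈ 𝓝 z) (hH : Continuous H)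
    (hd : ∀ᶠ n in l, ∀ y ∈ S, HasLineDerivAt ℝ (Gn n) (Hn n y) y e)
    (hGn : ∀ y, Tendsto (fun n ↦ Gn n y) l (𝓝 (G y)))
    (hHn : ∀ y, Tendsto (fun p : ι × Plane ↦ Hn p.1 p.2) (l ×ˢ 𝓝 y) (𝓝 (H y))) :
    HasLineDerivAt ℝ G (H z) z e := by
  obtain ⟨O, hOS, hO, hzO⟩ := mem_nhds_iff.1 hS
  have hc : Continuous fun s : ℝ ↦ z + s • e := by fun_prop
  have key := hasDerivAt_of_tendstoLocallyUniformlyOn (𝕜 := ℝ) (l := l)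
    (s := (fun s : ℝ ↦ z + s • e) ⁻¹' O) (x := 0)
    (f := fun n s ↦ Gn n (z + s • e)) (f' := fun n s ↦ Hn n (z + s • e))
    (g := fun s ↦ G (z + s • e)) (g' := fun s ↦ H (z + s • e)) (hO.preimage hc) ?_ ?_
    (fun s _ ↦ hGn _) (by simpa using hzO)
  · simpa [HasLineDerivAt] using key
  · rw [tendstoLocallyUniformlyOn_iff_forall_tendsto]
    intro s _
    have h1 : Tendsto (fun y : ι × ℝ ↦ H (z + y.2 • e)) (l ×ˢ 𝓝[(fun s : ℝ ↦ z + s • e) ⁻¹' O] s)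
        (𝓝 (H (z + s • e))) :=
      (((hH.comp hc).tendsto s).mono_left nhdsWithin_le_nhds).comp tendsto_snd
    have h2 : Tendsto (fun y : ι × ℝ ↦ Hn y.1 (z + y.2 • e))
        (l ×ˢ 𝓝[(fun s : ℝ ↦ z + s • e) ⁻¹' O] s) (𝓝 (H (z + s • e))) :=
      (hHn (z + s • e)).comp (tendsto_fst.prodMk
        (((hc.tendsto s).mono_left nhdsWithin_le_nhds).comp tendsto_snd))
    exact (h1.prodMk_nhds h2).mono_right (nhds_le_uniformity _)
  · filter_upwards [hd] with n hn s hs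
    exact hasLineDerivAt_add_smul_iff.1 (hn _ (hOS hs))

/-- Differentiating the convolution puts the derivative on the bump f. The weak identity tested with
t ↦ f (y - t) moves it over to H; the ball condition makes this a test function on U. -/
theorem hasLineDerivAt_mollify {U : Set Plane} {G H : Plane → ℂ} (hG : Continuous G)
    {e : Plane}
    (h : ∀ η : 𝓢(Plane, ℂ), IsTestOn U η → ∫ z, (∂_{e} η) z * G z = -∫ z, η z * H z)
    (b : ContDiffBump (0 : Plane)) {y : Plane} (hy : Metric.closedBall y b.rOut ⊆ U) :
    HasLineDerivAt ℝ (b.normed volume ⋆[ContinuousLinearMap.lsmul ℝ ℝ, volume] G)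
      ((b.normed volume ⋆[ContinuousLinearMap.lsmul ℝ ℝ, volume] H) y) y e := by
  set f : Plane → ℝ := b.normed volume with hf
  have hfs : ContDiff ℝ ∞ f := b.contDiff_normed
  have hfc : HasCompactSupport f := b.hasCompactSupport_normed
  have h1 := (hfc.hasFDerivAt_convolution_left (ContinuousLinearMap.lsmul ℝ ℝ)
    (hfs.of_le (by norm_cast)) hG.locallyIntegrable (μ := volume) y).hasLineDerivAt e
  suffices hval : (f ⋆[ContinuousLinearMap.lsmul ℝ ℝ, volume] H) y
      = (fderiv ℝ f ⋆[(ContinuousLinearMap.lsmul ℝ ℝ : ℝ →L[ℝ] ℂ →L[ℝ] ℂ).precompL Plane,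
        volume] G) y e by
    rw [hval]
    exact h1
  have hc : HasCompactSupport (fun t : Plane ↦ ((f (y - t) : ℝ) : ℂ)) :=
    (hfc.comp_homeomorph (Homeomorph.subLeft y)).comp_left (g := fun r : ℝ ↦ (r : ℂ))
      Complex.ofReal_zero
  have hcd : ContDiff ℝ ∞ (fun t : Plane ↦ ((f (y - t) : ℝ) : ℂ)) :=
    Complex.ofRealCLM.contDiff.comp (hfs.comp (contDiff_const.sub contDiff_id))
  set η : 𝓢(Plane, ℂ) := hc.toSchwartzMap hcd with hηd
  have hηt : tsupport η ⊆ Metric.closedBall y b.rOut := by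
    refine closure_minimal (fun t ht ↦ ?_) Metric.isClosed_closedBall
    have h2 : f (y - t) ≠ 0 := fun h0 ↦ ht (by
      change ((f (y - t) : ℝ) : ℂ) = 0
      rw [h0, Complex.ofReal_zero])
    have h3 : y - t ∈ Metric.ball (0 : Plane) b.rOut := by
      rw [← b.support_normed_eq (μ := volume)]
      exact h2
    rw [Metric.mem_closedBall, dist_comm, dist_eq_norm]
    simpa using (mem_ball_zero_iff.1 h3).le
  have hη : IsTestOn U η := ⟨hc, hηt.trans hy⟩
  have hder : ∀ t, (∂_{e} η) t = -((fderiv ℝ f (y - t) e : ℝ) : ℂ) := fun t ↦ by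
    rw [SchwartzMap.lineDerivOp_apply_eq_fderiv]
    have h2 : HasFDerivAt (fun t : Plane ↦ f (y - t)) (-(fderiv ℝ f (y - t))) t := by
      have h3 := (hfs.differentiable (by simp) (y - t)).hasFDerivAt.comp t
        ((hasFDerivAt_id t).const_sub y)
      exact h3.congr_fderiv (by ext v; simp)
    have h4 := (Complex.ofRealCLM.hasFDerivAt (x := f (y - t))).comp t h2
    have h5 : (η : Plane → ℂ) = Complex.ofRealCLM ∘ fun t : Plane ↦ f (y - t) := rfl
    rw [h5, h4.fderiv]
    simp
  have hex := ((hfc.fderiv ℝ).convolutionExists_left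
    ((ContinuousLinearMap.lsmul ℝ ℝ : ℝ →L[ℝ] ℂ →L[ℝ] ℂ).precompL Plane)
    (hfs.continuous_fderiv (by simp)) hG.locallyIntegrable (μ := volume)) y
  rw [convolution_def, convolution_def, ContinuousLinearMap.integral_apply hex.integrable]
  have h6 := h η hη
  simp_rw [hder] at h6
  have h7 : ∀ g : Plane → ℂ, ∫ t, g t = ∫ t, g (y - t) := fun g ↦
    (integral_sub_left_eq_self g volume y).symm
  rw [h7, h7 fun t ↦ η t * H t] at h6
  have h8 : ∀ t, η (y - t) = ((f t : ℝ) : ℂ) := fun t ↦ by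
    change ((f (y - (y - t)) : ℝ) : ℂ) = _
    rw [sub_sub_cancel]
  simp only [h8, sub_sub_cancel, neg_mul, integral_neg, neg_inj] at h6
  simp only [ContinuousLinearMap.precompL_apply, ContinuousLinearMap.lsmul_apply,
    Complex.real_smul]
  exact h6.symm

/-- A continuous function whose weak directional derivative is continuous is differentiable in
that direction. -/
theorem hasLineDerivAt_of_weak {U : Set Plane} (hU : IsOpen U) {G H : Plane → ℂ}
    (hG : Continuous G) (hH : Continuous H) {e : Plane}
    (h : ∀ η : 𝓢(Plane, ℂ), IsTestOn U η → ∫ z, (∂_{e} η) z * G z = -∫ z, η z * H z)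
    {z : Plane} (hz : z ∈ U) : HasLineDerivAt ℝ G (H z) z e := by
  obtain ⟨r, hr, hrU⟩ := Metric.isOpen_iff.1 hU z hz
  obtain ⟨b, hb⟩ : ∃ b : ℕ → ContDiffBump (0 : Plane),
      Tendsto (fun n ↦ (b n).rOut) atTop (𝓝 0) :=
    ⟨fun n ↦ ⟨1 / (2 * ((n : ℝ) + 1)), 1 / ((n : ℝ) + 1), by positivity,
      one_div_lt_one_div_of_lt (by positivity) (by nlinarith [(Nat.cast_nonneg n : (0 : ℝ) ≤ n)])⟩,
      tendsto_one_div_add_atTop_nhds_zero_nat⟩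
  refine hasLineDerivAt_of_tendsto (l := atTop) (Metric.ball_mem_nhds z (half_pos hr)) hH
    (Gn := fun n ↦ ((b n).normed volume ⋆[ContinuousLinearMap.lsmul ℝ ℝ, volume] G))
    (Hn := fun n ↦ ((b n).normed volume ⋆[ContinuousLinearMap.lsmul ℝ ℝ, volume] H)) ?_
    (fun y ↦ ?_) fun y ↦ ?_
  · filter_upwards [hb.eventually (gt_mem_nhds (half_pos hr))] with n hn y hy
    refine hasLineDerivAt_mollify hG h (b n) fun w hw ↦ hrU ?_
    rw [Metric.mem_closedBall] at hw
    rw [Metric.mem_ball] at hy ⊢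
    linarith [dist_triangle w y z]
  · exact ContDiffBump.convolution_tendsto_right hb
      (Eventually.of_forall fun _ ↦ hG.aestronglyMeasurable)
      ((hG.tendsto y).comp tendsto_snd) tendsto_const_nhds
  -- Indexing by pairs (n, moving evaluation point) gives joint convergence, which is the locally
  -- uniform convergence of the derivatives.
  · obtain ⟨b', hb'⟩ : ∃ b' : ℕ × Plane → ContDiffBump (0 : Plane), ∀ p, b' p = b p.1 :=
      ⟨fun p ↦ b p.1, fun _ ↦ rfl⟩
    have h1 : Tendsto (fun p ↦ (b' p).rOut) (atTop ×ˢ 𝓝 y) (𝓝 0) := by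
      simp_rw [hb']
      exact hb.comp tendsto_fst
    have h2 : Tendsto (Function.uncurry fun _ : ℕ × Plane ↦ H) ((atTop ×ˢ 𝓝 y) ×ˢ 𝓝 y)
        (𝓝 (H y)) := (hH.tendsto y).comp tendsto_snd
    have h3 : Tendsto (fun p : ℕ × Plane ↦ p.2) (atTop ×ˢ 𝓝 y) (𝓝 y) := tendsto_snd
    have h4 := ContDiffBump.convolution_tendsto_right (μ := volume) (E' := ℂ) h1
      (Eventually.of_forall fun _ ↦ hH.aestronglyMeasurable) h2 h3
    simpa only [hb'] using h4

end KdVSystem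

/-! ### Leibniz algebra for (P + 2)^k on a quadratic form. -/

namespace KdVSystem

open Finset.HasAntidiagonal (antidiagonal)

section Algebra

theorem fst_le_of_mem_antidiagonal {n : ℕ} {p : ℕ × ℕ} (hp : p ∈ antidiagonal n) : p.1 ≤ n := by
  have := Finset.HasAntidiagonal.mem_antidiagonal.1 hp
  omega

theorem snd_le_of_mem_antidiagonal {n : ℕ} {p : ℕ × ℕ} (hp : p ∈ antidiagonal n) : p.2 ≤ n := by
  have := Finset.HasAntidiagonal.mem_antidiagonal.1 hp
  omega

/-- The binomial sum `∑ (n choose i) f i (n - i)`. -/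
noncomputable def binomSum (n : ℕ) (f : ℕ → ℕ → ℂ) : ℂ :=
  ∑ p ∈ antidiagonal n, (n.choose p.1 : ℂ) * f p.1 p.2

/-- Pascal's rule, in the form that passes from the Leibniz formula of order n to that of order n +
1. -/
theorem binomSum_succ (n : ℕ) (f : ℕ → ℕ → ℂ) :
    binomSum (n + 1) f = binomSum n (fun i j ↦ f (i + 1) j + f i (j + 1)) := by
  rw [binomSum, Finset.sum_antidiagonal_choose_succ_mul, binomSum, ← Finset.sum_add_distrib]
  refine Finset.sum_congr rfl fun p hp ↦ ?_
  rw [Finset.HasAntidiagonal.mem_antidiagonal] at hp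
  rw [show n.choose p.2 = n.choose p.1 from (Nat.choose_symm_of_eq_add hp.symm).symm]
  ring

theorem binomSum_zero (f : ℕ → ℕ → ℂ) : binomSum 0 f = f 0 0 := by simp [binomSum]

theorem binomSum_add (n : ℕ) (f g : ℕ → ℕ → ℂ) :
    binomSum n (fun i j ↦ f i j + g i j) = binomSum n f + binomSum n g := by
  simp only [binomSum, mul_add, Finset.sum_add_distrib]

theorem binomSum_mul_left (n : ℕ) (c : ℂ) (f : ℕ → ℕ → ℂ) :
    binomSum n (fun i j ↦ c * f i j) = c * binomSum n f := by
  simp only [binomSum, mul_left_comm _ c, Finset.mul_sum]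

theorem hasDerivAt_binomSum {n : ℕ} {f : ℕ → ℕ → ℝ → ℂ} {f' : ℕ → ℕ → ℂ} {s : ℝ}
    (h : ∀ i j, i ≤ n → j ≤ n → HasDerivAt (f i j) (f' i j) s) :
    HasDerivAt (fun s ↦ binomSum n (fun i j ↦ f i j s)) (binomSum n f') s :=
  HasDerivAt.fun_sum fun p hp ↦ (h p.1 p.2 (fst_le_of_mem_antidiagonal hp)
    (snd_le_of_mem_antidiagonal hp)).const_mul _

theorem _root_.ContinuousOn.binomSum {n : ℕ} {f : ℕ → ℕ → Plane → ℂ} {S : Set Plane}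
    (h : ∀ i j, i ≤ n → j ≤ n → ContinuousOn (f i j) S) :
    ContinuousOn (fun z ↦ binomSum n (fun i j ↦ f i j z)) S :=
  continuousOn_finsetSum _ fun p hp ↦ continuousOn_const.mul (h p.1 p.2
    (fst_le_of_mem_antidiagonal hp) (snd_le_of_mem_antidiagonal hp))

theorem _root_.ContDiff.binomSum {n : ℕ} {f : ℕ → ℕ → Plane → ℂ} {m : WithTop ℕ∞}
    (h : ∀ i j, ContDiff ℝ m (f i j)) :
    ContDiff ℝ m (fun z ↦ binomSum n (fun i j ↦ f i j z)) :=
  ContDiff.sum fun p _ ↦ contDiff_const.mul (h p.1 p.2)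

/-- The value at `0` of `(S + 2)^j V`, with `S` the shift. -/
noncomputable def shiftAddTwo (V : ℕ → ℂ) (j : ℕ) : ℂ :=
  binomSum j (fun m n ↦ 2 ^ n * V m)

theorem shiftAddTwo_succ (V : ℕ → ℂ) (j : ℕ) :
    shiftAddTwo V (j + 1) = shiftAddTwo (fun m ↦ V (m + 1)) j + 2 * shiftAddTwo V j := by
  rw [shiftAddTwo, binomSum_succ, binomSum_add, shiftAddTwo, shiftAddTwo, ← binomSum_mul_left]
  congr 2
  ext i j
  ring

/-- The Leibniz expansion of `(P + 2)^k` applied to the quadratic form `q`, polarized. -/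
noncomputable def flux (q : Fin 2 → Fin 2 → Fin 2 → ℂ) (V W : Fin 2 → ℕ → ℂ) (α : Fin 2)
    (k : ℕ) : ℂ :=
  ∑ β, ∑ γ, q α β γ * binomSum k (fun i j ↦ V β i * shiftAddTwo (W γ) j)

variable {q : Fin 2 → Fin 2 → Fin 2 → ℂ}

/-- An index shift stands for P. On a product, P + 2 acts as P on the left factor plus P + 2 on the
right one, which is why only the second slot of `flux` carries `shiftAddTwo`. -/
theorem flux_succ (V : Fin 2 → ℕ → ℂ) (α : Fin 2) (k : ℕ) :
    flux q V V α (k + 1) = flux q (fun β m ↦ V β (m + 1)) V α k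
      + flux q V (fun β m ↦ V β (m + 1)) α k + 2 * flux q V V α k := by
  simp only [flux, Finset.mul_sum, ← Finset.sum_add_distrib]
  refine Finset.sum_congr rfl fun β _ ↦ Finset.sum_congr rfl fun γ _ ↦ ?_
  rw [mul_left_comm 2, ← mul_add, ← mul_add, ← binomSum_mul_left k 2, binomSum_succ,
    ← binomSum_add, ← binomSum_add]
  congr 2
  ext i j
  rw [shiftAddTwo_succ]
  ring

theorem hasDerivAt_shiftAddTwo {V : ℕ → ℝ → ℂ} {V' : ℕ → ℂ} {s : ℝ}
    (h : ∀ m, HasDerivAt (V m) (V' m) s) (j : ℕ) :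
    HasDerivAt (fun s ↦ shiftAddTwo (fun m ↦ V m s) j) (shiftAddTwo V' j) s :=
  hasDerivAt_binomSum (f := fun m n s ↦ 2 ^ n * V m s) fun m _ _ _ ↦ (h m).const_mul _

theorem hasDerivAt_flux {V W : Fin 2 → ℕ → ℝ → ℂ} {V' W' : Fin 2 → ℕ → ℂ} {s : ℝ}
    (hV : ∀ β m, HasDerivAt (V β m) (V' β m) s) (hW : ∀ β m, HasDerivAt (W β m) (W' β m) s)
    (α : Fin 2) (k : ℕ) :
    HasDerivAt (fun s ↦ flux q (fun β m ↦ V β m s) (fun β m ↦ W β m s) α k)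
      (flux q V' (fun β m ↦ W β m s) α k + flux q (fun β m ↦ V β m s) W' α k) s := by
  have h : HasDerivAt (fun s ↦ flux q (fun β m ↦ V β m s) (fun β m ↦ W β m s) α k)
      (∑ β, ∑ γ, q α β γ * binomSum k (fun i j ↦ V' β i * shiftAddTwo (fun m ↦ W γ m s) j
        + V β i s * shiftAddTwo (W' γ) j)) s :=
    HasDerivAt.fun_sum fun β _ ↦ HasDerivAt.fun_sum fun γ _ ↦ HasDerivAt.const_mul _
      (hasDerivAt_binomSum (f := fun i j s ↦ V β i s * shiftAddTwo (fun m ↦ W γ m s) j)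
        fun i j _ _ ↦ (hV β i).mul (hasDerivAt_shiftAddTwo (hW γ) j))
  convert! h using 1
  simp only [flux, ← Finset.sum_add_distrib, ← mul_add, ← binomSum_add]

theorem _root_.ContinuousOn.flux {V W : Fin 2 → ℕ → Plane → ℂ} {S : Set Plane}
    (hV : ∀ β m, ContinuousOn (V β m) S) (hW : ∀ β m, ContinuousOn (W β m) S)
    (α : Fin 2) (k : ℕ) :
    ContinuousOn (fun z ↦ flux q (fun β m ↦ V β m z) (fun β m ↦ W β m z) α k) S :=
  continuousOn_finsetSum _ fun β _ ↦ continuousOn_finsetSum _ fun γ _ ↦ continuousOn_const.mul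
    (ContinuousOn.binomSum (f := fun i j z ↦ V β i z * shiftAddTwo (fun m ↦ W γ m z) j)
      fun i _ _ _ ↦ (hV β i).mul (ContinuousOn.binomSum (f := fun m n z ↦ 2 ^ n * W γ m z)
        fun m _ _ _ ↦ continuousOn_const.mul (hW γ m)))

theorem _root_.ContDiff.flux {V W : Fin 2 → ℕ → Plane → ℂ} {n : WithTop ℕ∞}
    (hV : ∀ β m, ContDiff ℝ n (V β m)) (hW : ∀ β m, ContDiff ℝ n (W β m)) (α : Fin 2) (k : ℕ) :
    ContDiff ℝ n (fun z ↦ flux q (fun β m ↦ V β m z) (fun β m ↦ W β m z) α k) :=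
  ContDiff.sum fun β _ ↦ ContDiff.sum fun γ _ ↦ contDiff_const.mul
    (ContDiff.binomSum (f := fun i j z ↦ V β i z * shiftAddTwo (fun m ↦ W γ m z) j)
      fun i _ ↦ (hV β i).mul (ContDiff.binomSum (f := fun m n z ↦ 2 ^ n * W γ m z)
        fun m _ ↦ contDiff_const.mul (hW γ m)))

end Algebra

/-! ### The recursion for the x-derivatives of P^k u. -/

section Tower

variable {q : Fin 2 → Fin 2 → Fin 2 → ℂ} {V : Fin 2 → ℕ → Plane → ℂ}

/-- The functions which represent `∂ₓ^l P^k u_α`: for `l ≥ 3` they are obtained from the equation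
`3 t ∂ₓ³ P^k u = -P^{k+1} u + x ∂ₓ P^k u - 3 t ∂ₓ (P + 2)^k q(u)`. -/
noncomputable def tower (q : Fin 2 → Fin 2 → Fin 2 → ℂ) (V : Fin 2 → ℕ → Plane → ℂ) :
    ℕ → Fin 2 → ℕ → Plane → ℂ
  | 0, α, k, z => V α k z
  | 1, α, k, z => fderiv ℝ (V α k) z ex
  | 2, α, k, z => fderiv ℝ (fun y ↦ fderiv ℝ (V α k) y ex) z ex
  | l + 3, α, k, z =>
    -(tower q V l α (k + 1) z - ((z 0 : ℝ) : ℂ) * tower q V (l + 1) α k z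
        - l * tower q V l α k z) / (3 * ((z 1 : ℝ) : ℂ))
      - ∑ p ∈ (antidiagonal (l + 1)).attach, ((l + 1).choose p.1.1 : ℂ) *
          flux q (fun β m ↦ tower q V p.1.1 β m z) (fun β m ↦ tower q V p.1.2 β m z) α k
  termination_by l => l
  decreasing_by
    all_goals first
      | omega
      | (have := fst_le_of_mem_antidiagonal p.2; omega)
      | (have := snd_le_of_mem_antidiagonal p.2; omega)

theorem tower_zero (α : Fin 2) (k : ℕ) : tower q V 0 α k = V α k := by
  ext z
  rw [tower]

theorem tower_one (α : Fin 2) (k : ℕ) (z : Plane) :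
    tower q V 1 α k z = fderiv ℝ (V α k) z ex := by
  rw [tower]

theorem tower_two (α : Fin 2) (k : ℕ) (z : Plane) :
    tower q V 2 α k z = fderiv ℝ (fun y ↦ fderiv ℝ (V α k) y ex) z ex := by
  rw [tower]

theorem tower_add_three (l : ℕ) (α : Fin 2) (k : ℕ) (z : Plane) :
    tower q V (l + 3) α k z =
      -(tower q V l α (k + 1) z - ((z 0 : ℝ) : ℂ) * tower q V (l + 1) α k z
        - l * tower q V l α k z) / (3 * ((z 1 : ℝ) : ℂ))
      - binomSum (l + 1) (fun i j ↦ flux q (fun β m ↦ tower q V i β m z)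
          (fun β m ↦ tower q V j β m z) α k) := by
  rw [tower, binomSum]
  congr 1
  let F : ℕ × ℕ → ℂ := fun p ↦ ((l + 1).choose p.1 : ℂ) *
    flux q (fun β m ↦ tower q V p.1 β m z) (fun β m ↦ tower q V p.2 β m z) α k
  exact Finset.sum_attach (antidiagonal (l + 1)) F

/-- The `C²` functions `V α k` represent `P^k u_α` on the square, for a solution `u` of
`∂ₜ u_α + ∂ₓ³ u_α + ∂ₓ q_α(u, u) = 0`. -/
structure IsSolutionFamily (x₀ t₀ ε : ℝ) (q : Fin 2 → Fin 2 → Fin 2 → ℂ)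
    (V : Fin 2 → ℕ → Plane → ℂ) : Prop where
  contDiff : ∀ α k, ContDiff ℝ 2 (V α k)
  eqOn_dilation : ∀ α k, Set.EqOn (V α (k + 1)) (dilation (V α k)) (square x₀ t₀ ε)
  weak : ∀ α k η, IsTestOn (square x₀ t₀ ε) η →
    ∫ z, dualL η z * V α k z
      = ∫ z, (∂_{ex} η) z * flux q (fun β m ↦ V β m z) (fun β m ↦ V β m z) α k

/-- The square including its boundary at the initial and the final time. -/
def strip (x₀ t₀ ε : ℝ) : Set Plane :=
  {z | z 0 ∈ Set.Ioo (x₀ - ε) (x₀ + ε) ∧ z 1 ∈ Set.Icc (t₀ - ε) (t₀ + ε)}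

variable {x₀ t₀ ε : ℝ}

theorem square_subset_strip : square x₀ t₀ ε ⊆ strip x₀ t₀ ε :=
  fun _ hz ↦ ⟨hz.1, Set.Ioo_subset_Icc_self hz.2⟩

theorem strip_subset_closedSquare : strip x₀ t₀ ε ⊆ closedSquare x₀ t₀ ε :=
  fun _ hz ↦ ⟨Set.Ioo_subset_Icc_self hz.1, hz.2⟩

/-- Points of the closed square are approached along the segment from the centre. Identities between
continuous functions therefore extend to the boundary. -/
theorem closedSquare_subset_closure (hε : 0 < ε) :
    closedSquare x₀ t₀ ε ⊆ closure (square x₀ t₀ ε) := by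
  intro z hz
  have hc : Continuous fun s : ℝ ↦ !₂[x₀, t₀] + s • (z - !₂[x₀, t₀]) := by fun_prop
  have ht := (hc.tendsto 1).mono_left (nhdsWithin_le_nhds (s := Set.Iio (1 : ℝ)))
  rw [one_smul, add_sub_cancel] at ht
  refine mem_closure_of_tendsto ht ?_
  have h0 : ∀ᶠ s in nhdsWithin (1 : ℝ) (Set.Iio 1), 0 < s :=
    nhdsWithin_le_nhds (lt_mem_nhds one_pos)
  filter_upwards [h0, self_mem_nhdsWithin] with s hs0 hs1
  have hs1 : s < 1 := hs1
  obtain ⟨⟨h1, h2⟩, h3, h4⟩ := hz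
  refine ⟨⟨?_, ?_⟩, ?_, ?_⟩ <;> simp <;> nlinarith

theorem ne_zero_of_mem_closedSquare (hεt : ε < |t₀|) {z : Plane} (hz : z ∈ closedSquare x₀ t₀ ε) :
    z 1 ≠ 0 := by
  intro h
  have h1 := hz.2
  rw [h] at h1
  exact absurd (abs_le.2 ⟨by linarith [h1.2], by linarith [h1.1]⟩) (not_le.2 hεt)

/-- The direction `ex` is tangent to the time slices, so a boundary slice is a limit of interior
ones and `hasLineDerivAt_of_tendsto` applies. It is needed because the supremum includes the times
t₀ ± ε. -/
theorem hasLineDerivAt_strip (hε : 0 < ε) {G H : Plane → ℂ} (hG : Continuous G) (hH : Continuous H)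
    (h : ∀ z ∈ square x₀ t₀ ε, HasLineDerivAt ℝ G (H z) z ex) {z : Plane}
    (hz : z ∈ strip x₀ t₀ ε) : HasLineDerivAt ℝ G (H z) z ex := by
  let freeze : ℝ → Plane → Plane := fun s y ↦ !₂[y 0, s]
  have hf : Continuous fun p : ℝ × Plane ↦ freeze p.1 p.2 := by
    dsimp only [freeze]
    fun_prop
  have hline : ∀ s y (r : ℝ), freeze s (y + r • ex) = freeze s y + r • ex := by
    intro s y r
    ext i
    fin_cases i <;> simp [freeze]
  have hz1 : freeze (z 1) z = z := by
    ext i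
    fin_cases i <;> simp [freeze]
  have hne : (nhdsWithin (z 1) (Set.Ioo (t₀ - ε) (t₀ + ε))).NeBot := by
    rw [← mem_closure_iff_nhdsWithin_neBot, closure_Ioo (by linarith)]
    exact hz.2
  have key := hasLineDerivAt_of_tendsto (l := nhdsWithin (z 1) (Set.Ioo (t₀ - ε) (t₀ + ε)))
    (G := fun y ↦ G (freeze (z 1) y)) (H := fun y ↦ H (freeze (z 1) y))
    (Gn := fun s y ↦ G (freeze s y)) (Hn := fun s y ↦ H (freeze s y)) (z := z) (e := ex)
    (S := {y | y 0 ∈ Set.Ioo (x₀ - ε) (x₀ + ε)})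
    ((isOpen_Ioo.preimage (by fun_prop : Continuous fun z : Plane ↦ z 0)).mem_nhds hz.1)
    (hH.comp (hf.comp (by fun_prop : Continuous fun y : Plane ↦ ((z 1 : ℝ), y)))) ?_ ?_ ?_
  · rw [hz1] at key
    rw [HasLineDerivAt] at key ⊢
    simpa only [hline, hz1] using key
  · filter_upwards [self_mem_nhdsWithin] with s hs y hy
    have h1 := h (freeze s y) ⟨by simpa [freeze] using hy, by simpa [freeze] using hs⟩
    rw [HasLineDerivAt] at h1 ⊢
    simpa only [hline] using h1
  · intro y
    have h1 := ((hG.comp hf).tendsto (z 1, y)).comp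
      ((Filter.tendsto_id.prodMk_nhds tendsto_const_nhds) :
        Filter.Tendsto (fun s : ℝ ↦ (s, y)) (nhds (z 1)) (nhds (z 1, y)))
    exact h1.mono_left nhdsWithin_le_nhds
  · intro y
    have h1 := (hH.comp hf).tendsto (z 1, y)
    rw [nhds_prod_eq] at h1
    exact h1.mono_left (Filter.prod_mono_left _ nhdsWithin_le_nhds)

theorem _root_.ContDiff.hasLineDerivAt {G : Plane → ℂ} (hG : ContDiff ℝ 1 G) (z e : Plane) :
    HasLineDerivAt ℝ G (fderiv ℝ G z e) z e :=
  (hG.differentiable one_ne_zero z).hasFDerivAt.hasLineDerivAt e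

theorem contDiff_fderiv_ex {G : Plane → ℂ} (hG : ContDiff ℝ 2 G) :
    ContDiff ℝ 1 (fun z ↦ fderiv ℝ G z ex) :=
  (hG.fderiv_right (m := 1) (by norm_num)).clm_apply contDiff_const

theorem fderiv_flux (hV : ∀ β m, ContDiff ℝ 2 (V β m)) (α : Fin 2) (k : ℕ) (z e : Plane) :
    fderiv ℝ (fun z ↦ flux q (fun β m ↦ V β m z) (fun β m ↦ V β m z) α k) z e
      = flux q (fun β m ↦ fderiv ℝ (V β m) z e) (fun β m ↦ V β m z) α k
        + flux q (fun β m ↦ V β m z) (fun β m ↦ fderiv ℝ (V β m) z e) α k := by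
  have hV1 : ∀ β m, ContDiff ℝ 1 (V β m) := fun β m ↦ (hV β m).of_le (by norm_num)
  have h1 := (ContDiff.flux (q := q) hV1 hV1 α k).hasLineDerivAt z e
  have h2 : ∀ β m, HasDerivAt (fun r : ℝ ↦ V β m (z + r • e)) (fderiv ℝ (V β m) z e) 0 :=
    fun β m ↦ (hV1 β m).hasLineDerivAt z e
  have h3 := hasDerivAt_flux (q := q) h2 h2 α k
  simp only [zero_smul, add_zero] at h3
  exact HasDerivAt.unique h1 h3

theorem dilation_eq_fderiv (G : Plane → ℂ) (z : Plane) :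
    dilation G z = fderiv ℝ G z ((3 * z 1) • et + (z 0) • ex) := by
  simp [dilation]

/-- The inductive step for the fluxes: the operator P + 2 produced by `airy_P_apply` raises k by
one. -/
theorem dilation_flux (hV : ∀ β m, ContDiff ℝ 2 (V β m)) (α : Fin 2) (k : ℕ) (z : Plane)
    (hz : ∀ β m, V β (m + 1) z = dilation (V β m) z) :
    dilation (fun z ↦ flux q (fun β m ↦ V β m z) (fun β m ↦ V β m z) α k) z
        + 2 * flux q (fun β m ↦ V β m z) (fun β m ↦ V β m z) α k
      = flux q (fun β m ↦ V β m z) (fun β m ↦ V β m z) α (k + 1) := by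
  rw [dilation_eq_fderiv, fderiv_flux hV, flux_succ]
  simp only [← dilation_eq_fderiv, hz]

namespace IsSolutionFamily

variable (h : IsSolutionFamily x₀ t₀ ε q V)
include h

/-- C² regularity allows every derivative in the weak equation to be moved off η except one of the
three ∂ₓ. What remains is a weak formula for the third derivative with a continuous right side. -/
theorem weak_third (α : Fin 2) (k : ℕ) {η : 𝓢(Plane, ℂ)} (hη : IsTestOn (square x₀ t₀ ε) η) :
    ∫ z, (∂_{ex} η) z * tower q V 2 α k z
      = -∫ z, η z * (-fderiv ℝ (V α k) z et
        - fderiv ℝ (fun z ↦ flux q (fun β m ↦ V β m z) (fun β m ↦ V β m z) α k) z ex) := by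
  have hU := isOpen_square x₀ t₀ ε
  have hV1 : ContDiff ℝ 1 (V α k) := (h.contDiff α k).of_le (by norm_num)
  have hV2 := contDiff_fderiv_ex (h.contDiff α k)
  have hM : ContDiff ℝ 1 (fun z ↦ flux q (fun β m ↦ V β m z) (fun β m ↦ V β m z) α k) :=
    ContDiff.flux (fun β m ↦ (h.contDiff β m).of_le (by norm_num))
      (fun β m ↦ (h.contDiff β m).of_le (by norm_num)) α k
  have hw := h.weak α k η hη
  rw [hη.integral_fderiv hU hM] at hw
  have hx := hη.lineDeriv ex
  have hxx := hx.lineDeriv ex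
  have hxxx := hxx.lineDeriv ex
  have h1 : ∀ z, dualL η z * V α k z = -((∂_{et} η) z * V α k z)
      - (∂_{ex} (∂_{ex} (∂_{ex} η)) : 𝓢(Plane, ℂ)) z * V α k z := fun z ↦ by
    rw [dualL, sub_apply, neg_apply]
    ring
  simp_rw [h1] at hw
  rw [integral_sub ((hη.lineDeriv et).integrable_mul_of_continuous hV1.continuous).fun_neg
    (hxxx.integrable_mul_of_continuous hV1.continuous), integral_neg,
    hη.integral_fderiv hU hV1, hxx.integral_fderiv hU hV1, hx.integral_fderiv hU hV2] at hw
  simp_rw [tower_two, mul_sub, mul_neg]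
  rw [integral_sub (hη.integrable_mul_of_continuous (hV1.continuous_fderiv_dir et)).fun_neg
    (hη.integrable_mul_of_continuous (hM.continuous_fderiv_dir ex)), integral_neg]
  linear_combination -hw

/-- Substituting P V = 3tVₜ + xVₓ into the recursion and cancelling 3t ≠ 0 recovers the equation
itself; on the boundary the formula for P V holds by continuity. -/
theorem tower_three (hε : 0 < ε) (hεt : ε < |t₀|) (α : Fin 2) (k : ℕ) {z : Plane}
    (hz : z ∈ closedSquare x₀ t₀ ε) :
    tower q V 3 α k z = -fderiv ℝ (V α k) z et
        - fderiv ℝ (fun z ↦ flux q (fun β m ↦ V β m z) (fun β m ↦ V β m z) α k) z ex := by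
  have hV1 : ContDiff ℝ 1 (V α k) := (h.contDiff α k).of_le (by norm_num)
  have h1 : V α (k + 1) z = dilation (V α k) z :=
    (h.eqOn_dilation α k).closure (h.contDiff α (k + 1)).continuous (continuous_dilation hV1)
      (closedSquare_subset_closure hε hz)
  have h2 : ((z 1 : ℝ) : ℂ) ≠ 0 :=
    Complex.ofReal_ne_zero.2 (ne_zero_of_mem_closedSquare hεt hz)
  rw [fderiv_flux h.contDiff, show (3 : ℕ) = 0 + 3 from rfl, tower_add_three, binomSum_succ,
    binomSum_zero]
  simp only [tower_zero, zero_add, tower_one, h1, dilation, Nat.cast_zero]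
  congr 1
  field_simp
  ring

/-- The functions of the tower are the successive derivatives in `x`. -/
theorem hasLineDerivAt_tower (hε : 0 < ε) (hεt : ε < |t₀|) (l : ℕ) (α : Fin 2) (k : ℕ) {z : Plane}
    (hz : z ∈ strip x₀ t₀ ε) :
    HasLineDerivAt ℝ (tower q V l α k) (tower q V (l + 1) α k z) z ex := by
  induction l using Nat.strong_induction_on generalizing α k with
  | _ l ih =>
    match l, ih with
    | 0, _ =>
      rw [tower_zero, zero_add, tower_one]
      exact ((h.contDiff α k).of_le (by norm_num)).hasLineDerivAt z ex
    | 1, _ =>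
      have h1 : tower q V 1 α k = fun z ↦ fderiv ℝ (V α k) z ex := funext (tower_one α k)
      rw [h1, tower_two]
      exact (contDiff_fderiv_ex (h.contDiff α k)).hasLineDerivAt z ex
    | 2, _ =>
      have h1 : tower q V 2 α k = fun z ↦ fderiv ℝ (fun y ↦ fderiv ℝ (V α k) y ex) z ex :=
        funext (tower_two α k)
      have hG : Continuous (tower q V 2 α k) := by
        rw [h1]
        exact (contDiff_fderiv_ex (h.contDiff α k)).continuous_fderiv_dir ex
      have hV1 : ∀ β m, ContDiff ℝ 1 (V β m) := fun β m ↦ (h.contDiff β m).of_le (by norm_num)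
      have hH := ((hV1 α k).continuous_fderiv_dir et).neg.sub
        ((ContDiff.flux (q := q) hV1 hV1 α k).continuous_fderiv_dir ex)
      rw [h.tower_three hε hεt α k (strip_subset_closedSquare hz)]
      exact hasLineDerivAt_strip hε hG hH (fun y hy ↦ hasLineDerivAt_of_weak
        (isOpen_square x₀ t₀ ε) hG hH (fun η hη ↦ h.weak_third α k hη) hy) hz
    -- The formula of order l + 3 involves only orders up to l + 1, already known to be
    -- differentiable. Differentiating x∂ₓ^{l+1} turns the coefficient l into l + 1, and
    -- `binomSum_succ` handles the flux.
    | l + 3, ih =>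
      have hd : ∀ i ≤ l + 1, ∀ β m, HasDerivAt (fun r : ℝ ↦ tower q V i β m (z + r • ex))
          (tower q V (i + 1) β m z) 0 := fun i hi β m ↦ ih i (by omega) β m
      have hx : HasDerivAt (fun r : ℝ ↦ (((z + r • ex) 0 : ℝ) : ℂ)) 1 0 := by
        have h1 : HasDerivAt (fun r : ℝ ↦ z 0 + r) 1 0 := (hasDerivAt_id (0 : ℝ)).const_add _
        simpa using h1.ofReal_comp
      have hB := hasDerivAt_binomSum (n := l + 1) (s := 0)
        (f := fun i j (r : ℝ) ↦ flux q (fun β m ↦ tower q V i β m (z + r • ex))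
          (fun β m ↦ tower q V j β m (z + r • ex)) α k)
        (fun i j hi hj ↦ hasDerivAt_flux (hd i hi) (hd j hj) α k)
      have hT := ((((hd l (by omega) α (k + 1)).sub
        (hx.mul (hd (l + 1) le_rfl α k))).sub ((hd l (by omega) α k).const_mul (l : ℂ))).neg.div_const
        (3 * ((z 1 : ℝ) : ℂ))).sub hB
      have hfun : (fun r : ℝ ↦ tower q V (l + 3) α k (z + r • ex)) = fun r : ℝ ↦
          -(tower q V l α (k + 1) (z + r • ex)
            - (((z + r • ex) 0 : ℝ) : ℂ) * tower q V (l + 1) α k (z + r • ex)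
            - l * tower q V l α k (z + r • ex)) / (3 * ((z 1 : ℝ) : ℂ))
          - binomSum (l + 1) (fun i j ↦ flux q (fun β m ↦ tower q V i β m (z + r • ex))
              (fun β m ↦ tower q V j β m (z + r • ex)) α k) := by
        ext r
        rw [tower_add_three]
        simp
      rw [HasLineDerivAt, hfun]
      convert! hT using 1
      rw [show l + 3 + 1 = (l + 1) + 3 from rfl, tower_add_three, binomSum_succ]
      simp only [zero_smul, add_zero]
      push_cast
      ring

theorem continuousOn_tower (hεt : ε < |t₀|) (l : ℕ) (α : Fin 2) (k : ℕ) :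
    ContinuousOn (tower q V l α k) (closedSquare x₀ t₀ ε) := by
  induction l using Nat.strong_induction_on generalizing α k with
  | _ l ih =>
    match l, ih with
    | 0, _ =>
      rw [tower_zero]
      exact (h.contDiff α k).continuous.continuousOn
    | 1, _ =>
      rw [show tower q V 1 α k = _ from funext (tower_one α k)]
      exact (contDiff_fderiv_ex (h.contDiff α k)).continuous.continuousOn
    | 2, _ =>
      rw [show tower q V 2 α k = _ from funext (tower_two α k)]
      exact ((contDiff_fderiv_ex (h.contDiff α k)).continuous_fderiv_dir ex).continuousOn
    | l + 3, ih =>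
      rw [show tower q V (l + 3) α k = _ from funext (tower_add_three l α k)]
      refine ContinuousOn.sub (ContinuousOn.div (ContinuousOn.neg ?_) ?_ ?_) ?_
      · exact ((ih l (by omega) α (k + 1)).sub ((continuous_coord 0).continuousOn.mul
          (ih (l + 1) (by omega) α k))).sub (continuousOn_const.mul (ih l (by omega) α k))
      · exact continuousOn_const.mul (continuous_coord 1).continuousOn
      · intro z hz
        exact mul_ne_zero three_ne_zero
          (Complex.ofReal_ne_zero.2 (ne_zero_of_mem_closedSquare hεt hz))
      · exact ContinuousOn.binomSum (f := fun i j z ↦ flux q (fun β m ↦ tower q V i β m z)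
          (fun β m ↦ tower q V j β m z) α k) fun i j hi hj ↦
          ContinuousOn.flux (ih i (by omega)) (ih j (by omega)) α k

end IsSolutionFamily

end Tower

end KdVSystem

/-! ### Gevrey estimates of order two. -/

namespace KdVSystem

open Finset.HasAntidiagonal (antidiagonal)

section Gevrey

theorem choose_mul_factorial_add_le (m n l : ℕ) :
    (m + n).choose m * (m + l)! ≤ (m + n + l)! := by
  have h1 : (m + n).choose m ≤ (m + l + n).choose n := by
    rw [Nat.choose_symm_add]
    exact Nat.choose_le_choose n (by omega)
  have h2 := Nat.add_choose_mul_factorial_mul_factorial (m + l) n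
  calc (m + n).choose m * (m + l)! ≤ (m + l + n).choose n * (m + l)! := by gcongr
    _ ≤ (m + l + n).choose n * (m + l)! * n ! := Nat.le_mul_of_pos_right _ (Nat.factorial_pos n)
    _ = (m + n + l)! := by rw [h2, add_right_comm]

/-- The product of binomials is a single term of Vandermonde's sum. It handles the Leibniz
coefficients in P and in ∂ₓ at once. -/
theorem choose_mul_choose_mul_factorial_le (i j p r : ℕ) :
    (i + j).choose i * (p + r).choose p * ((i + p)! * (j + r)!) ≤ (i + j + (p + r))! := by
  have h1 : (i + j).choose i * (p + r).choose p ≤ (i + p + (j + r)).choose (i + p) := by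
    rw [show i + p + (j + r) = (i + j) + (p + r) by ring, Nat.add_choose_eq (i + j) (p + r) (i + p)]
    exact Finset.single_le_sum (f := fun ij : ℕ × ℕ ↦ (i + j).choose ij.1 * (p + r).choose ij.2)
      (fun _ _ ↦ Nat.zero_le _) (a := (i, p))
      (Finset.HasAntidiagonal.mem_antidiagonal.2 rfl)
  have h2 := Nat.add_choose_mul_factorial_mul_factorial (i + p) (j + r)
  rw [← Nat.choose_symm_add] at h2
  calc _ ≤ (i + p + (j + r)).choose (i + p) * ((i + p)! * (j + r)!) := by gcongr
    _ = (i + j + (p + r))! := by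
      rw [← mul_assoc, h2]
      congr 1
      ring

theorem norm_binomSum_le {n : ℕ} {f : ℕ → ℕ → ℂ} {B : ℝ}
    (h : ∀ i j, i + j = n → (n.choose i : ℝ) * ‖f i j‖ ≤ B) : ‖binomSum n f‖ ≤ (n + 1) * B := by
  have h1 : ‖binomSum n f‖ ≤ (antidiagonal n).card • B := by
    refine norm_sum_le_of_le _ (fun p hp ↦ ?_) |>.trans (le_of_eq (Finset.sum_const B))
    rw [norm_mul, Complex.norm_natCast]
    exact h _ _ (Finset.HasAntidiagonal.mem_antidiagonal.1 hp)
  rw [Finset.Nat.card_antidiagonal, nsmul_eq_mul] at h1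
  exact_mod_cast h1

/-- The weights `c Aⁿ (n!)²` of the Gevrey class of order `2`. -/
noncomputable def gevrey (c A : ℝ) (n : ℕ) : ℝ := c * A ^ n * (n ! : ℝ) ^ 2

theorem gevrey_nonneg {c A : ℝ} (hc : 0 ≤ c) (hA : 0 ≤ A) (n : ℕ) : 0 ≤ gevrey c A n := by
  rw [gevrey]
  positivity

theorem gevrey_succ (c A : ℝ) (n : ℕ) :
    gevrey c A (n + 1) = A * ((n : ℝ) + 1) ^ 2 * gevrey c A n := by
  rw [gevrey, gevrey, Nat.factorial_succ]
  push_cast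
  ring

theorem gevrey_le_succ {c A : ℝ} (hc : 0 ≤ c) (hA : 1 ≤ A) (n : ℕ) :
    gevrey c A n ≤ gevrey c A (n + 1) := by
  rw [gevrey_succ]
  refine le_mul_of_one_le_left (gevrey_nonneg hc (by linarith) n) ?_
  have : (0 : ℝ) ≤ n := Nat.cast_nonneg n
  nlinarith

/-- Of the two factorials in the weight one absorbs the binomial coefficient and the other is only
monotone; A ≥ 2 absorbs 2^n. The factor j + 1 counts the terms. -/
theorem norm_shiftAddTwo_le {c A : ℝ} (hc : 0 ≤ c) (hA : 2 ≤ A) {W : ℕ → ℂ} {l : ℕ}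
    (hW : ∀ m, ‖W m‖ ≤ gevrey c A (m + l)) (j : ℕ) :
    ‖shiftAddTwo W j‖ ≤ (j + 1) * gevrey c A (j + l) := by
  refine norm_binomSum_le fun m n hmn ↦ ?_
  subst hmn
  have h1 : (((m + n).choose m : ℕ) : ℝ) * ((m + l)! : ℝ) ≤ ((m + n + l)! : ℝ) := by
    exact_mod_cast choose_mul_factorial_add_le m n l
  have h2 : ((m + l)! : ℝ) ≤ ((m + n + l)! : ℝ) := by
    exact_mod_cast Nat.factorial_le (by omega)
  have hA0 : 0 ≤ A := by linarith
  rw [norm_mul, norm_pow, Complex.norm_ofNat]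
  calc (((m + n).choose m : ℕ) : ℝ) * (2 ^ n * ‖W m‖)
      ≤ (((m + n).choose m : ℕ) : ℝ) * (A ^ n * gevrey c A (m + l)) := by
        gcongr
        exact hW m
    _ = c * A ^ (m + n + l) * (((((m + n).choose m : ℕ) : ℝ) * ((m + l)! : ℝ)) * (m + l)!) := by
        rw [gevrey]
        ring
    _ ≤ c * A ^ (m + n + l) * (((m + n + l)! : ℝ) * (m + n + l)!) := by gcongr
    _ = gevrey c A (m + n + l) := by
        rw [gevrey]
        ring

variable {q : Fin 2 → Fin 2 → Fin 2 → ℂ}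

/-- N stands for the outer Leibniz coefficient, carried inside so that both binomials can be
absorbed together. -/
theorem mul_norm_flux_le {V W : Fin 2 → ℕ → ℂ} {α : Fin 2} {k : ℕ} {N B Q : ℝ} (hN : 0 ≤ N)
    (hB : 0 ≤ B) (hQ : ∑ β, ∑ γ, ‖q α β γ‖ ≤ Q)
    (h : ∀ β γ i j, i + j = k →
      N * ((k.choose i : ℝ) * (‖V β i‖ * ‖shiftAddTwo (W γ) j‖)) ≤ B) :
    N * ‖flux q V W α k‖ ≤ Q * ((k + 1) * B) := by
  have h1 : ∀ β γ, N * ‖binomSum k (fun i j ↦ V β i * shiftAddTwo (W γ) j)‖ ≤ (k + 1) * B := by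
    intro β γ
    rw [← Real.norm_of_nonneg hN, ← Complex.norm_real, ← norm_mul, ← binomSum_mul_left]
    refine norm_binomSum_le fun i j hij ↦ ?_
    rw [norm_mul, norm_mul, Complex.norm_real, Real.norm_of_nonneg hN]
    exact (le_of_eq (by ring)).trans (h β γ i j hij)
  calc N * ‖flux q V W α k‖
      ≤ N * ∑ β, ∑ γ, ‖q α β γ‖ * ‖binomSum k (fun i j ↦ V β i * shiftAddTwo (W γ) j)‖ := by
        refine mul_le_mul_of_nonneg_left ?_ hN
        refine norm_sum_le_of_le _ fun β _ ↦ norm_sum_le_of_le _ fun γ _ ↦ ?_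
        rw [norm_mul]
    _ = ∑ β, ∑ γ, ‖q α β γ‖ *
          (N * ‖binomSum k (fun i j ↦ V β i * shiftAddTwo (W γ) j)‖) := by
        simp only [Finset.mul_sum]
        refine Finset.sum_congr rfl fun β _ ↦ Finset.sum_congr rfl fun γ _ ↦ ?_
        ring
    _ ≤ ∑ β, ∑ γ, ‖q α β γ‖ * ((k + 1) * B) := by
        exact Finset.sum_le_sum fun β _ ↦ Finset.sum_le_sum fun γ _ ↦
          mul_le_mul_of_nonneg_left (h1 β γ) (norm_nonneg _)
    _ = (∑ β, ∑ γ, ‖q α β γ‖) * ((k + 1) * B) := by simp only [Finset.sum_mul]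
    _ ≤ Q * ((k + 1) * B) := by gcongr

/-- One pair of factorials absorbs both binomials. The factors L + 1 and k + 1 count terms, the
second k + 1 comes from `norm_shiftAddTwo_le`, and the extra c from multiplying two weights. -/
theorem norm_binomSum_flux_le {c A Q : ℝ} (hc : 0 ≤ c) (hA : 2 ≤ A) {α : Fin 2}
    (hQ : ∑ β, ∑ γ, ‖q α β γ‖ ≤ Q) {L : ℕ} {D : ℕ → Fin 2 → ℕ → ℂ}
    (hD : ∀ l ≤ L, ∀ β m, ‖D l β m‖ ≤ gevrey c A (m + l)) (k : ℕ) :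
    ‖binomSum L (fun i j ↦ flux q (D i) (D j) α k)‖
      ≤ (L + 1) * (Q * ((k + 1) * ((k + 1) * (c * gevrey c A (k + L))))) := by
  have hA0 : 0 ≤ A := by linarith
  refine norm_binomSum_le fun p r hpr ↦ ?_
  have hg := gevrey_nonneg hc hA0 (k + L)
  refine mul_norm_flux_le (Nat.cast_nonneg _) (by positivity) hQ fun β γ i j hij ↦ ?_
  subst hpr hij
  have h1 : (((i + j).choose i : ℕ) : ℝ) * (((p + r).choose p : ℕ) : ℝ)
      * (((i + p)! : ℝ) * ((j + r)! : ℝ)) ≤ ((i + j + (p + r))! : ℝ) := by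
    exact_mod_cast choose_mul_choose_mul_factorial_le i j p r
  have h2 : ((i + p)! : ℝ) * ((j + r)! : ℝ) ≤ ((i + j + (p + r))! : ℝ) := by
    have := Nat.le_of_dvd (Nat.factorial_pos _) (Nat.factorial_mul_factorial_dvd_factorial_add
      (i + p) (j + r))
    rw [show i + p + (j + r) = i + j + (p + r) by ring] at this
    exact_mod_cast this
  have h3 : ‖shiftAddTwo (D r γ) j‖ ≤ ((i + j : ℕ) + 1) * gevrey c A (j + r) := by
    refine (norm_shiftAddTwo_le hc hA (hD r (by omega) γ) j).trans ?_
    have := gevrey_nonneg hc hA0 (j + r)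
    gcongr
    omega
  have h4 := hD p (by omega) β i
  have h5 := gevrey_nonneg hc hA0 (i + p)
  calc (((p + r).choose p : ℕ) : ℝ) * ((((i + j).choose i : ℕ) : ℝ) *
        (‖D p β i‖ * ‖shiftAddTwo (D r γ) j‖))
      ≤ (((p + r).choose p : ℕ) : ℝ) * ((((i + j).choose i : ℕ) : ℝ) *
        (gevrey c A (i + p) * (((i + j : ℕ) + 1) * gevrey c A (j + r)))) := by gcongr
    _ = ((i + j : ℕ) + 1) * (c * (c * A ^ (i + j + (p + r)) *
        (((((i + j).choose i : ℕ) : ℝ) * (((p + r).choose p : ℕ) : ℝ)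
          * (((i + p)! : ℝ) * ((j + r)! : ℝ))) * (((i + p)! : ℝ) * ((j + r)! : ℝ))))) := by
        rw [gevrey, gevrey]
        ring
    _ ≤ ((i + j : ℕ) + 1) * (c * (c * A ^ (i + j + (p + r)) *
        (((i + j + (p + r))! : ℝ) * ((i + j + (p + r))! : ℝ)))) := by gcongr
    _ = ((i + j : ℕ) + 1) * (c * gevrey c A (i + j + (p + r))) := by
        rw [gevrey]
        ring

/-- Gevrey bounds for `l ≤ 2` propagate along the tower. -/
theorem norm_tower_le {V : Fin 2 → ℕ → Plane → ℂ} {z : Plane} {c A Q X τ : ℝ} (hc : 0 ≤ c)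
    (hA : 2 ≤ A) (hQ : ∀ α, ∑ β, ∑ γ, ‖q α β γ‖ ≤ Q) (hX : |z 0| ≤ X) (hτ : 0 < τ)
    (hτz : τ ≤ |z 1|) (hAc : (1 + X) / (3 * τ) + Q * c ≤ A)
    (hbase : ∀ l ≤ 2, ∀ α k, ‖tower q V l α k z‖ ≤ gevrey c A (k + l)) (l : ℕ) (α : Fin 2)
    (k : ℕ) : ‖tower q V l α k z‖ ≤ gevrey c A (k + l) := by
  have hA0 : 0 ≤ A := by linarith
  have hX0 : 0 ≤ X := (abs_nonneg _).trans hX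
  have hQ0 : 0 ≤ Q := le_trans (by positivity) (hQ 0)
  induction l using Nat.strong_induction_on generalizing α k with
  | _ l ih =>
    match l, ih with
    | 0, _ => exact hbase 0 (by norm_num) α k
    | 1, _ => exact hbase 1 (by norm_num) α k
    | 2, _ => exact hbase 2 le_rfl α k
    | l + 3, ih =>
      set b : ℝ := gevrey c A (k + l + 1) with hb
      have hb0 : 0 ≤ b := gevrey_nonneg hc hA0 _
      have hk0 : (0 : ℝ) ≤ k := Nat.cast_nonneg k
      have hl0 : (0 : ℝ) ≤ l := Nat.cast_nonneg l
      have h1 : ‖tower q V l α (k + 1) z‖ ≤ b := by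
        refine (ih l (by omega) α (k + 1)).trans (le_of_eq ?_)
        rw [hb]
        congr 1
        ring
      have h2 : ‖((z 0 : ℝ) : ℂ) * tower q V (l + 1) α k z‖ ≤ X * b := by
        rw [norm_mul, Complex.norm_real]
        exact mul_le_mul hX (ih (l + 1) (by omega) α k) (norm_nonneg _) hX0
      have h3 : ‖(l : ℂ) * tower q V l α k z‖ ≤ l * b := by
        rw [norm_mul, Complex.norm_natCast]
        exact mul_le_mul_of_nonneg_left ((ih l (by omega) α k).trans
          (gevrey_le_succ hc (by linarith) _)) hl0
      have h4 : ‖-(tower q V l α (k + 1) z - ((z 0 : ℝ) : ℂ) * tower q V (l + 1) α k z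
          - l * tower q V l α k z) / (3 * ((z 1 : ℝ) : ℂ))‖
          ≤ (b + X * b + l * b) / (3 * τ) := by
        rw [norm_div, norm_neg, norm_mul, Complex.norm_ofNat, Complex.norm_real, Real.norm_eq_abs]
        have h5 := norm_sub_le (tower q V l α (k + 1) z - ((z 0 : ℝ) : ℂ) * tower q V (l + 1) α k z)
          (l * tower q V l α k z)
        have h6 := norm_sub_le (tower q V l α (k + 1) z)
          (((z 0 : ℝ) : ℂ) * tower q V (l + 1) α k z)
        gcongr
        linarith
      have h5 := norm_binomSum_flux_le (q := q) hc hA (hQ α) (L := l + 1)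
        (D := fun i β m ↦ tower q V i β m z) (fun i hi β m ↦ ih i (by omega) β m) k
      rw [← add_assoc, ← hb] at h5
      -- The target weight is A²Rb. R dominates the coefficient l and the counts of Leibniz terms,
      -- one A pays for the constants through `hAc`, and the other A is spare.
      set R : ℝ := (((k : ℝ) + l + 2) * ((k : ℝ) + l + 3)) ^ 2 with hR
      have hR3 : ((k : ℝ) + l + 2) ^ 3 ≤ R := by
        rw [hR, mul_pow]
        have : (1 : ℝ) ≤ (k : ℝ) + l + 2 := by linarith
        calc ((k : ℝ) + l + 2) ^ 3 = ((k : ℝ) + l + 2) ^ 2 * ((k : ℝ) + l + 2) := by ring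
          _ ≤ ((k : ℝ) + l + 2) ^ 2 * ((k : ℝ) + l + 3) ^ 2 := by
            gcongr
            nlinarith
      have hR1 : 1 + X + l ≤ (1 + X) * R := by
        have h6 : 1 + (l : ℝ) ≤ ((k : ℝ) + l + 2) ^ 3 :=
          le_trans (by linarith) (le_self_pow₀ (by linarith : (1 : ℝ) ≤ (k : ℝ) + l + 2)
            three_ne_zero)
        have h7 : 1 + (l : ℝ) ≤ R := h6.trans hR3
        nlinarith
      have hR2 : ((l : ℝ) + 1 + 1) * (((k : ℝ) + 1) * ((k : ℝ) + 1)) ≤ R := by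
        refine le_trans ?_ hR3
        calc ((l : ℝ) + 1 + 1) * (((k : ℝ) + 1) * ((k : ℝ) + 1))
            ≤ ((k : ℝ) + l + 2) * (((k : ℝ) + l + 2) * ((k : ℝ) + l + 2)) :=
              mul_le_mul (by linarith) (mul_le_mul (by linarith) (by linarith) (by linarith)
                (by linarith)) (by positivity) (by positivity)
          _ = _ := by ring
      rw [tower_add_three]
      have hgoal : gevrey c A (k + (l + 3)) = A * A * (R * b) := by
        rw [show k + (l + 3) = k + l + 1 + 1 + 1 by ring, gevrey_succ, gevrey_succ, ← hb, hR]
        push_cast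
        ring
      rw [hgoal]
      refine (norm_sub_le _ _).trans ((add_le_add h4 h5).trans ?_)
      push_cast
      calc (b + X * b + l * b) / (3 * τ) +
            ((l : ℝ) + 1 + 1) * (Q * (((k : ℝ) + 1) * (((k : ℝ) + 1) * (c * b))))
          = (1 + X + l) * b / (3 * τ)
            + Q * c * ((((l : ℝ) + 1 + 1) * (((k : ℝ) + 1) * ((k : ℝ) + 1))) * b) := by ring
        _ ≤ (1 + X) * R * b / (3 * τ) + Q * c * (R * b) := by gcongr
        _ = ((1 + X) / (3 * τ) + Q * c) * (R * b) := by ring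
        _ ≤ A * (R * b) := by gcongr
        _ ≤ A * A * (R * b) := by
          rw [mul_assoc]
          exact le_mul_of_one_le_left (by positivity) (by linarith)

end Gevrey

end KdVSystem

namespace KdVSystem

/-! ### H¹ norms on time slices. -/

section SliceNorm

/-- Only points in the support of η, hence in J, enter the integration by parts, so nothing is asked
of f elsewhere. -/
theorem hasWeakDerivOn_of_hasDerivAt {J : Set ℝ} (hJ : IsOpen J) {f g : ℝ → ℂ}
    (hg : ContinuousOn g J) (h : ∀ x ∈ J, HasDerivAt f (g x) x) : HasWeakDerivOn J f g := by
  have hf : ContinuousOn f J := fun x hx ↦ (h x hx).continuousAt.continuousWithinAt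
  refine ⟨hf.locallyIntegrableOn hJ.measurableSet, hg.locallyIntegrableOn hJ.measurableSet,
    fun η hη hηc hηJ ↦ ?_⟩
  have hint : ∀ (θ : ℝ → ℝ) (G : ℝ → ℂ), Continuous θ → tsupport θ ⊆ tsupport η →
      ContinuousOn G J → Integrable (fun x ↦ ((θ x : ℝ) : ℂ) * G x) := by
    intro θ G hθ hθη hG
    have h1 : IntegrableOn (fun x ↦ ((θ x : ℝ) : ℂ) * G x) (tsupport η) :=
      ContinuousOn.integrableOn_compact hηc
        ((Complex.continuous_ofReal.comp hθ).continuousOn.mul (hG.mono hηJ))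
    refine (integrableOn_iff_integrable_of_support_subset fun z hz ↦ hθη ?_).1 h1
    refine subset_tsupport _ fun h0 ↦ hz ?_
    simp [h0]
  have hd : Continuous (deriv η) := hη.continuous_deriv (by norm_cast)
  have key := integral_bilinear_hasLineDerivAt_right_eq_neg_left_of_integrable (μ := volume)
    (f := fun x ↦ ((η x : ℝ) : ℂ)) (f' := fun x ↦ ((deriv η x : ℝ) : ℂ)) (g := f) (g' := g)
    (v := (1 : ℝ)) (B := ContinuousLinearMap.mul ℝ ℂ)
    (hint _ _ hd tsupport_deriv_subset hf) (hint _ _ hη.continuous subset_rfl hg)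
    (hint _ _ hη.continuous subset_rfl hf)
    (fun x _ ↦ by
      have h1 := ((hη.differentiable (by simp) x).hasDerivAt).ofReal_comp
      simpa using h1.hasFDerivAt.hasLineDerivAt 1)
    (fun x hx ↦ by
      have hx' : x ∈ J := hηJ (closure_mono (fun y hy (h0 : η y = 0) ↦ (Function.mem_support.1 hy) (by simp [h0])) hx)
      simpa using (h x hx').hasFDerivAt.hasLineDerivAt 1)
  simp only [ContinuousLinearMap.mul_apply'] at key
  rw [key, neg_neg]

theorem h1Norm_Ioo_le {x₀ ε B : ℝ} (hε : 0 < ε) (hB : 0 ≤ B) {f g : ℝ → ℂ}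
    (hg : ContinuousOn g (Set.Ioo (x₀ - ε) (x₀ + ε)))
    (h : ∀ x ∈ Set.Ioo (x₀ - ε) (x₀ + ε), HasDerivAt f (g x) x)
    (hfB : ∀ x ∈ Set.Ioo (x₀ - ε) (x₀ + ε), ‖f x‖ ≤ B)
    (hgB : ∀ x ∈ Set.Ioo (x₀ - ε) (x₀ + ε), ‖g x‖ ≤ B) :
    h1Norm (Set.Ioo (x₀ - ε) (x₀ + ε)) f
      ≤ ENNReal.ofReal (2 * (2 * ε) ^ (1 / 2 : ℝ) * B) := by
  have hbound : ∀ F : ℝ → ℂ, (∀ x ∈ Set.Ioo (x₀ - ε) (x₀ + ε), ‖F x‖ ≤ B) →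
      eLpNorm F 2 (volume.restrict (Set.Ioo (x₀ - ε) (x₀ + ε)))
        ≤ ENNReal.ofReal ((2 * ε) ^ (1 / 2 : ℝ) * B) := by
    intro F hF
    refine (eLpNorm_le_of_ae_bound (C := B)
      ((ae_restrict_iff' measurableSet_Ioo).2 (Filter.Eventually.of_forall hF))).trans ?_
    rw [Measure.restrict_apply_univ, Real.volume_Ioo, show x₀ + ε - (x₀ - ε) = 2 * ε by ring]
    rw [ENNReal.ofReal_mul (p := (2 * ε) ^ (1 / 2 : ℝ)) (by positivity),
      ← ENNReal.ofReal_rpow_of_nonneg (by positivity) (by norm_num)]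
    norm_num
  have h1 : h1Norm (Set.Ioo (x₀ - ε) (x₀ + ε)) f ≤ _ :=
    iInf₂_le g (hasWeakDerivOn_of_hasDerivAt isOpen_Ioo hg h)
  refine h1.trans ?_
  calc _ ≤ ((eLpNorm f 2 (volume.restrict (Set.Ioo (x₀ - ε) (x₀ + ε)))
        + eLpNorm g 2 (volume.restrict (Set.Ioo (x₀ - ε) (x₀ + ε)))) ^ 2) ^ (1 / 2 : ℝ) := by
        gcongr
        rw [add_sq']
        exact le_self_add
    _ = eLpNorm f 2 (volume.restrict (Set.Ioo (x₀ - ε) (x₀ + ε)))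
        + eLpNorm g 2 (volume.restrict (Set.Ioo (x₀ - ε) (x₀ + ε))) := by
        rw [← ENNReal.rpow_natCast, ← ENNReal.rpow_mul]
        norm_num
    _ ≤ ENNReal.ofReal ((2 * ε) ^ (1 / 2 : ℝ) * B) + ENNReal.ofReal ((2 * ε) ^ (1 / 2 : ℝ) * B) :=
        add_le_add (hbound f hfB) (hbound g hgB)
    _ ≤ ENNReal.ofReal (2 * (2 * ε) ^ (1 / 2 : ℝ) * B) := by
        rw [← ENNReal.ofReal_add (by positivity) (by positivity)]
        exact ENNReal.ofReal_le_ofReal (le_of_eq (by ring))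

/-- A crude bound suffices, since T^l is later merged into the geometric constant. -/
theorem abs_cbrt_le {t T : ℝ} (hT : 1 ≤ T) (ht : |t| ≤ T) : |cbrt t| ≤ T := by
  have h1 : |Real.sign t| ≤ 1 := by
    rcases Real.sign_apply_eq t with h | h | h <;> rw [h] <;> norm_num
  rw [cbrt, abs_mul, abs_of_nonneg (Real.rpow_nonneg (abs_nonneg t) _)]
  have h2 : |t| ^ (1 / 3 : ℝ) ≤ T := by
    calc |t| ^ (1 / 3 : ℝ) ≤ T ^ (1 / 3 : ℝ) := by gcongr
      _ ≤ T ^ (1 : ℝ) := Real.rpow_le_rpow_of_exponent_le hT (by norm_num)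
      _ = T := Real.rpow_one T
  calc |Real.sign t| * |t| ^ (1 / 3 : ℝ) ≤ 1 * T := by gcongr
    _ = T := one_mul T

end SliceNorm

/-! ### Assembly of regularity and estimates. -/

section Assembly

variable {x₀ t₀ ε : ℝ} {q : Fin 2 → Fin 2 → Fin 2 → ℂ} {V : Fin 2 → ℕ → Plane → ℂ}

/-- Induction on k through `airy_P_apply`. The identity `dilation_flux` is available only on the
square, which is enough because the test functions vanish outside it. -/
theorem isSolutionFamily {w : Fin 2 → 𝓢'(Plane, ℂ)} (hV : ∀ α k, ContDiff ℝ 2 (V α k))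
    (hw : ∀ α k η, IsTestOn (square x₀ t₀ ε) η → (P^[k] (w α)) η = ∫ z, η z * V α k z)
    (hweak : ∀ α η, IsTestOn (square x₀ t₀ ε) η → (∂_{et} (w α) + dxPow 3 (w α)) η
      = ∫ z, (∂_{ex} η) z * flux q (fun β m ↦ V β m z) (fun β m ↦ V β m z) α 0) :
    IsSolutionFamily x₀ t₀ ε q V := by
  have hU := isOpen_square x₀ t₀ ε
  have hV1 : ∀ β m, ContDiff ℝ 1 (V β m) := fun β m ↦ (hV β m).of_le (by norm_num)
  have hdil : ∀ α k, Set.EqOn (V α (k + 1)) (dilation (V α k)) (square x₀ t₀ ε) := fun α k ↦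
    KdVSystem.eqOn_dilation hU (hV1 α k) (hV α (k + 1)).continuous (hw α k) fun η hη ↦ by
      rw [← hw α (k + 1) η hη, Function.iterate_succ_apply']
  have hk : ∀ α k η, IsTestOn (square x₀ t₀ ε) η →
      (∂_{et} (P^[k] (w α)) + dxPow 3 (P^[k] (w α))) η
        = ∫ z, (∂_{ex} η) z * flux q (fun β m ↦ V β m z) (fun β m ↦ V β m z) α k := by
    intro α k
    induction k with
    | zero => exact hweak α
    | succ k ih =>
      intro η hη
      rw [Function.iterate_succ_apply', airy_P_apply hU (ContDiff.flux hV1 hV1 α k) ih hη]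
      refine integral_congr_ae (Filter.Eventually.of_forall fun z ↦ ?_)
      by_cases hz : z ∈ square x₀ t₀ ε
      · simp only
        rw [dilation_flux hV α k z fun β m ↦ hdil β m hz]
      · have : (∂_{ex} η) z = 0 :=
          image_eq_zero_of_notMem_tsupport fun h ↦ hz ((hη.lineDeriv ex).2 h)
        simp [this]
  refine ⟨hV, hdil, fun α k η hη ↦ ?_⟩
  rw [← hk α k η hη, airy_apply]
  refine (hw α k _ (isTestOn_of_tsupport_subset hη fun z hz ↦ ?_)).symm
  have h1 : ∀ θ : 𝓢(Plane, ℂ), tsupport θ ⊆ tsupport η → θ z = 0 := fun θ hθ ↦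
    image_eq_zero_of_notMem_tsupport fun h ↦ hz (hθ h)
  have h2 := fun θ : 𝓢(Plane, ℂ) ↦ SchwartzMap.tsupport_lineDerivOp_subset ex θ
  rw [dualL, sub_apply, neg_apply, h1 _ (SchwartzMap.tsupport_lineDerivOp_subset et η),
    h1 _ ((h2 _).trans ((h2 _).trans (h2 _)))]
  simp

namespace IsSolutionFamily

variable (h : IsSolutionFamily x₀ t₀ ε q V)
include h

theorem isGivenBy_tower (hε : 0 < ε) (hεt : ε < |t₀|) {w : 𝓢'(Plane, ℂ)} {α : Fin 2} {k : ℕ}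
    (hw : ∀ η, IsTestOn (square x₀ t₀ ε) η → w η = ∫ z, η z * V α k z) (l : ℕ) :
    IsGivenBy (square x₀ t₀ ε) (dxPow l w) (tower q V l α k) := by
  have hU := isOpen_square x₀ t₀ ε
  have hc : ∀ l, ContinuousOn (tower q V l α k) (square x₀ t₀ ε) := fun l ↦
    (h.continuousOn_tower hεt l α k).mono
      (square_subset_strip.trans strip_subset_closedSquare)
  refine ⟨(hc l).locallyIntegrableOn hU.measurableSet, ?_⟩
  induction l with
  | zero =>
    intro η hη
    rw [tower_zero]
    exact hw η hη
  | succ l ih =>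
    intro η hη
    have h1 : dxPow (l + 1) w = ∂_{ex} (dxPow l w) := Function.iterate_succ_apply' _ _ _
    rw [h1, lineDerivOp_apply_apply, map_neg, ih _ (hη.lineDeriv ex),
      hη.integral_lineDeriv_mul hU (hc l) (hc (l + 1))
        (fun z hz ↦ h.hasLineDerivAt_tower hε hεt l α k (square_subset_strip hz)), neg_neg]

theorem pointwiseBound (hε : 0 < ε) (hεt : ε < |t₀|) {w : 𝓢'(Plane, ℂ)} {α : Fin 2} {k l : ℕ}
    (hw : ∀ η, IsTestOn (square x₀ t₀ ε) η → w η = ∫ z, η z * V α k z) {B T : ℝ}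
    (hT : 1 ≤ T) (hT' : |t₀| + ε ≤ T)
    (hB : ∀ z ∈ closedSquare x₀ t₀ ε, ‖tower q V l α k z‖ ≤ B)
    (hB' : ∀ z ∈ closedSquare x₀ t₀ ε, ‖tower q V (l + 1) α k z‖ ≤ B) :
    PointwiseBound x₀ t₀ ε l w (2 * (2 * ε) ^ (1 / 2 : ℝ) * (T ^ l * B)) := by
  refine ⟨tower q V l α k, h.continuousOn_tower hεt l α k, h.isGivenBy_tower hε hεt hw l,
    iSup₂_le fun t ht ↦ ?_⟩
  have hcb : |cbrt t| ≤ T := by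
    refine abs_cbrt_le hT ((abs_le.2 ⟨?_, ?_⟩).trans hT')
    · linarith [ht.1, neg_abs_le t₀]
    · linarith [ht.2, le_abs_self t₀]
  have hmem : ∀ x ∈ Set.Ioo (x₀ - ε) (x₀ + ε), !₂[x, t] ∈ strip x₀ t₀ ε := fun x hx ↦
    ⟨by simpa using hx, by simpa using ht⟩
  have hle : ∀ (f : Plane → ℂ), (∀ z ∈ closedSquare x₀ t₀ ε, ‖f z‖ ≤ B) →
      ∀ x ∈ Set.Ioo (x₀ - ε) (x₀ + ε), ‖((cbrt t : ℝ) : ℂ) ^ l * f (!₂[x, t])‖ ≤ T ^ l * B := by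
    intro f hf x hx
    rw [norm_mul, norm_pow, Complex.norm_real, Real.norm_eq_abs]
    have := hf _ (strip_subset_closedSquare (hmem x hx))
    gcongr
  have hB0 : 0 ≤ B := by
    refine (norm_nonneg _).trans (hB !₂[x₀, t₀] ⟨?_, ?_⟩) <;> simp <;> linarith
  refine h1Norm_Ioo_le hε (by positivity)
    (g := fun x ↦ ((cbrt t : ℝ) : ℂ) ^ l * tower q V (l + 1) α k (!₂[x, t]))
    (continuousOn_const.mul ((h.continuousOn_tower hεt (l + 1) α k).comp
      (by fun_prop : Continuous fun x : ℝ ↦ (!₂[x, t] : Plane)).continuousOn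
      fun x hx ↦ strip_subset_closedSquare (hmem x hx)))
    (fun x hx ↦ HasDerivAt.const_mul _ ?_) (hle _ hB) (hle _ hB')
  have hline : ∀ r : ℝ, (!₂[r, t] : Plane) = !₂[0, t] + r • ex := fun r ↦ by
    ext i
    fin_cases i <;> simp
  have h1 := h.hasLineDerivAt_tower hε hεt l α k (hmem x hx)
  rw [hline x] at h1
  simpa only [← hline] using hasLineDerivAt_add_smul_iff.1 h1

end IsSolutionFamily

theorem norm_ex : ‖ex‖ = 1 := by simp [ex]

theorem norm_tower_le_of_iteratedFDeriv {α : Fin 2} {k : ℕ} {z : Plane} {B : ℝ}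
    (hV : ContDiff ℝ 2 (V α k)) (hB : ∀ n ≤ 2, ‖iteratedFDeriv ℝ n (V α k) z‖ ≤ B) {l : ℕ}
    (hl : l ≤ 2) : ‖tower q V l α k z‖ ≤ B := by
  refine le_trans ?_ (hB l hl)
  interval_cases l
  · rw [tower_zero, norm_iteratedFDeriv_zero]
  · have h1 := (iteratedFDeriv ℝ 1 (V α k) z).le_opNorm ![ex]
    rw [iteratedFDeriv_one_apply] at h1
    rw [tower_one]
    simpa [norm_ex] using h1
  · have h1 := (iteratedFDeriv ℝ 2 (V α k) z).le_opNorm ![ex, ex]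
    rw [iteratedFDeriv_two_apply] at h1
    have hd : DifferentiableAt ℝ (fderiv ℝ (V α k)) z :=
      (hV.fderiv_right (m := 1) (by norm_num)).differentiable one_ne_zero z
    rw [tower_two, fderiv_clm_apply hd (by fun_prop)]
    simpa [norm_ex, Fin.prod_univ_two] using h1

/-- The coefficients of the quadratic forms `a u²/2 + b v²/2 + c u v` and
`a' u²/2 + b' v²/2 + c' u v`. -/
noncomputable def coeff (a b c a' b' c' : ℝ) : Fin 2 → Fin 2 → Fin 2 → ℂ :=
  ![![![(a : ℂ) / 2, (c : ℂ)], ![0, (b : ℂ) / 2]], ![![(a' : ℂ) / 2, (c' : ℂ)], ![0, (b' : ℂ) / 2]]]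

theorem shiftAddTwo_zero (W : ℕ → ℂ) : shiftAddTwo W 0 = W 0 := by
  simp [shiftAddTwo, binomSum_zero]

theorem flux_zero (W : Fin 2 → ℕ → ℂ) (α : Fin 2) :
    flux q W W α 0 = q α 0 0 * W 0 0 ^ 2 + q α 1 1 * W 1 0 ^ 2
      + (q α 0 1 + q α 1 0) * (W 0 0 * W 1 0) := by
  simp only [flux, binomSum_zero, shiftAddTwo_zero, Fin.sum_univ_two]
  ring

/-- The representatives in which the system is posed agree almost everywhere on U with the
continuous ones, so the nonlinear terms may be rewritten. -/
theorem WeakEq.apply_eq {a b c : ℝ} {U : Set Plane} (hU : IsOpen U) {u v w : 𝓢'(Plane, ℂ)}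
    {f g F G : Plane → ℂ} (hw : WeakEq a b c U w f g) (hf : IsGivenBy U u f) (hg : IsGivenBy U v g)
    (hF : Continuous F) (hG : Continuous G) (hFu : ∀ η, IsTestOn U η → u η = ∫ z, η z * F z)
    (hGv : ∀ η, IsTestOn U η → v η = ∫ z, η z * G z) {η : 𝓢(Plane, ℂ)} (hη : IsTestOn U η) :
    (∂_{et} w + dxPow 3 w) η = ∫ z, (∂_{ex} η) z *
      ((a : ℂ) / 2 * F z ^ 2 + (b : ℂ) / 2 * G z ^ 2 + (c : ℂ) * (F z * G z)) := by
  have h1 := ae_eq_of_forall_isTestOn hU hf.1 (hF.locallyIntegrable.locallyIntegrableOn U)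
    fun η hη ↦ by rw [← hf.2 η hη, hFu η hη]
  have h2 := ae_eq_of_forall_isTestOn hU hg.1 (hG.locallyIntegrable.locallyIntegrableOn U)
    fun η hη ↦ by rw [← hg.2 η hη, hGv η hη]
  rw [hw η hη]
  refine integral_congr_ae ?_
  filter_upwards [h1, h2] with z hz1 hz2
  by_cases hz : z ∈ U
  · rw [hz1 hz, hz2 hz, mul_comm]
  · have : (∂_{ex} η) z = 0 :=
      image_eq_zero_of_notMem_tsupport fun h ↦ hz ((hη.lineDeriv ex).2 h)
    rw [this, mul_zero, zero_mul]

/-- The extra derivative in H¹ costs A(k + l + 1)², and (n + 1)² ≤ 4^n turns this into a larger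
geometric constant. -/
theorem gevrey_mul_pow_le {c A T : ℝ} (hc : 0 ≤ c) (hA : 0 ≤ A) (hT : 1 ≤ T) (k l : ℕ) :
    T ^ l * gevrey c A (k + (l + 1)) ≤ c * A * (4 * A * T) ^ (k + l) * ((k + l)! : ℝ) ^ 2 := by
  rw [← add_assoc, gevrey_succ, gevrey]
  have h1 : ((k + l : ℕ) : ℝ) + 1 ≤ 2 ^ (k + l) := by
    exact_mod_cast Nat.succ_le_of_lt (Nat.lt_two_pow_self (n := k + l))
  have h2 : (((k + l : ℕ) : ℝ) + 1) ^ 2 ≤ 4 ^ (k + l) := by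
    calc (((k + l : ℕ) : ℝ) + 1) ^ 2 ≤ (2 ^ (k + l)) ^ 2 := by gcongr
      _ = 4 ^ (k + l) := by rw [← pow_mul, mul_comm, pow_mul]; norm_num
  have h3 : T ^ l ≤ T ^ (k + l) := pow_le_pow_right₀ hT (by omega)
  calc T ^ l * (A * (((k + l : ℕ) : ℝ) + 1) ^ 2 * (c * A ^ (k + l) * ((k + l)! : ℝ) ^ 2))
      ≤ T ^ (k + l) * (A * 4 ^ (k + l) * (c * A ^ (k + l) * ((k + l)! : ℝ) ^ 2)) := by gcongr
    _ = _ := by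
      rw [mul_pow, mul_pow]
      ring

theorem PointwiseBound.mono {l : ℕ} {w : 𝓢'(Plane, ℂ)} {M M' : ℝ}
    (h : PointwiseBound x₀ t₀ ε l w M) (hM : M ≤ M') : PointwiseBound x₀ t₀ ε l w M' := by
  obtain ⟨W, hW, hw, hle⟩ := h
  exact ⟨W, hW, hw, hle.trans (ENNReal.ofReal_le_ofReal hM)⟩

/-- The pointwise bounds in vector form. -/
theorem pointwiseBound_of_sobolevNorm_le (q : Fin 2 → Fin 2 → Fin 2 → ℂ) (hε : 0 < ε)
    (hεt : ε < |t₀|) {ψ : Plane → ℝ} (hψ : ContDiff ℝ ∞ ψ) (hψc : HasCompactSupport ψ)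
    (hψ1 : ∀ z ∈ square x₀ t₀ ε, ψ z = 1) {C A₀ : ℝ} (hC : 0 < C) (hA₀ : 0 < A₀) :
    ∃ c₁ A : ℝ, 0 < c₁ ∧ 0 < A ∧ ∀ w : Fin 2 → 𝓢'(Plane, ℂ),
      (∀ α k, sobolevNorm (7 / 2) (cutoff ψ (P^[k] (w α)))
        ≤ ENNReal.ofReal (C * A₀ ^ k * (k ! : ℝ) ^ 2)) →
      (∀ V : Fin 2 → ℕ → Plane → ℂ, (∀ α k, Continuous (V α k)) →
        (∀ α k η, IsTestOn (square x₀ t₀ ε) η → (P^[k] (w α)) η = ∫ z, η z * V α k z) →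
        ∀ α η, IsTestOn (square x₀ t₀ ε) η → (∂_{et} (w α) + dxPow 3 (w α)) η
          = ∫ z, (∂_{ex} η) z * flux q (fun β m ↦ V β m z) (fun β m ↦ V β m z) α 0) →
      ∀ α k l, PointwiseBound x₀ t₀ ε l (P^[k] (w α)) (c₁ * A ^ (k + l) * ((k + l)! : ℝ) ^ 2) := by
  obtain ⟨K, hK, hSob⟩ := exists_contDiff_two_of_sobolevNorm_le
  set c : ℝ := K * C with hc
  have hc0 : 0 < c := by positivity
  set Q : ℝ := ∑ α, ∑ β, ∑ γ, ‖q α β γ‖ with hQd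
  have hQ : ∀ α, ∑ β, ∑ γ, ‖q α β γ‖ ≤ Q := fun α ↦
    Finset.single_le_sum (f := fun α ↦ ∑ β, ∑ γ, ‖q α β γ‖) (fun _ _ ↦ by positivity)
      (Finset.mem_univ α)
  have hQ0 : 0 ≤ Q := by positivity
  set X : ℝ := |x₀| + ε with hXd
  set τ : ℝ := |t₀| - ε with hτd
  have hX0 : 0 ≤ X := by positivity
  have hτ : 0 < τ := by linarith
  -- The summands serve in turn the shift by 2, the assumed bounds for l ≤ 2, and the recursion for
  -- l ≥ 3, where τ bounds |t| from below.
  set A : ℝ := 2 + A₀ + ((1 + X) / (3 * τ) + Q * c) with hAd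
  have hA' : 0 ≤ (1 + X) / (3 * τ) + Q * c := by positivity
  set T : ℝ := 1 + (|t₀| + ε) with hTd
  have hT : 1 ≤ T := by
    have := abs_nonneg t₀
    linarith
  have hA2 : 2 ≤ A := by linarith
  refine ⟨2 * (2 * ε) ^ (1 / 2 : ℝ) * (c * A), 4 * A * T, by positivity, by positivity,
    fun w hw hweak α k l ↦ ?_⟩
  choose V hV hVw hVb using fun α k ↦ hSob _ (C * A₀ ^ k * (k ! : ℝ) ^ 2) (by positivity) (hw α k)
  have hw' : ∀ α k η, IsTestOn (square x₀ t₀ ε) η → (P^[k] (w α)) η = ∫ z, η z * V α k z :=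
    fun α k η hη ↦ by rw [← hVw, cutoff_apply hψ hψc hψ1 _ hη]
  have hfam : IsSolutionFamily x₀ t₀ ε q V := isSolutionFamily hV hw'
    (hweak V (fun α k ↦ (hV α k).continuous) hw')
  have hbase : ∀ z, ∀ l ≤ 2, ∀ α k, ‖tower q V l α k z‖ ≤ gevrey c A (k + l) := by
    intro z l hl α k
    refine (norm_tower_le_of_iteratedFDeriv (hV α k) (fun n hn ↦ hVb α k n hn z) hl).trans ?_
    have h1 : A₀ ^ k ≤ A ^ (k + l) := by
      calc A₀ ^ k ≤ A ^ k := by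
            gcongr
            linarith
        _ ≤ A ^ (k + l) := pow_le_pow_right₀ (by linarith) (by omega)
    have h2 : (k ! : ℝ) ≤ ((k + l)! : ℝ) := by exact_mod_cast Nat.factorial_le (by omega)
    calc K * (C * A₀ ^ k * (k ! : ℝ) ^ 2) = c * A₀ ^ k * (k ! : ℝ) ^ 2 := by
          rw [hc]
          ring
      _ ≤ gevrey c A (k + l) := by
          rw [gevrey]
          gcongr
  have hbd : ∀ l, ∀ z ∈ closedSquare x₀ t₀ ε, ‖tower q V l α k z‖ ≤ gevrey c A (k + l) := by
    intro l z hz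
    refine norm_tower_le hc0.le hA2 hQ (X := X) (τ := τ) (abs_le.2 ⟨?_, ?_⟩) hτ ?_
      (by linarith) (hbase z) l α k
    · linarith [hz.1.1, neg_abs_le x₀]
    · linarith [hz.1.2, le_abs_self x₀]
    · have h1 : |t₀ - z 1| ≤ ε := abs_le.2 ⟨by linarith [hz.2.2], by linarith [hz.2.1]⟩
      linarith [abs_sub_abs_le_abs_sub t₀ (z 1)]
  refine (hfam.pointwiseBound hε hεt (hw' α k) hT (by linarith)
    (fun z hz ↦ (hbd l z hz).trans (gevrey_le_succ hc0.le (by linarith) _)) (hbd (l + 1))).mono ?_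
  have h1 := gevrey_mul_pow_le hc0.le (by linarith : (0 : ℝ) ≤ A) hT k l
  calc 2 * (2 * ε) ^ (1 / 2 : ℝ) * (T ^ l * gevrey c A (k + (l + 1)))
      ≤ 2 * (2 * ε) ^ (1 / 2 : ℝ) * (c * A * (4 * A * T) ^ (k + l) * ((k + l)! : ℝ) ^ 2) := by
        gcongr
    _ = _ := by ring

end Assembly

end KdVSystem

theorem proposition4p3
    -- the coefficients of the system
    (a b c a' b' c' : ℝ)
    -- the point, the size of the square, and the cut-off function
    (x₀ t₀ ε : ℝ) (hε : 0 < ε) (hεt : ε < |t₀|)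
    (ψ : KdVSystem.Plane → ℝ) (hψ : ContDiff ℝ ∞ ψ) (hψc : HasCompactSupport ψ)
    (hψ1 : ∀ z ∈ KdVSystem.square x₀ t₀ ε, ψ z = 1)
    -- the constants of the assumed bounds
    (C A₁ A₂ : ℝ) (hC : 0 < C) (hA₁ : 0 < A₁) (hA₂ : 0 < A₂) :
    ∃ c₁ A₃ A₄ : ℝ, 0 < c₁ ∧ 0 < A₃ ∧ 0 < A₄ ∧
      ∀ u v : 𝓢'(KdVSystem.Plane, ℂ),
        KdVSystem.IsSolutionOn a b c a' b' c' (KdVSystem.square x₀ t₀ ε) u v →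
        (∀ k : ℕ, KdVSystem.sobolevNorm (7 / 2) (KdVSystem.cutoff ψ (KdVSystem.P^[k] u))
          ≤ ENNReal.ofReal (C * A₁ ^ k * (k ! : ℝ) ^ 2)) →
        (∀ k : ℕ, KdVSystem.sobolevNorm (7 / 2) (KdVSystem.cutoff ψ (KdVSystem.P^[k] v))
          ≤ ENNReal.ofReal (C * A₂ ^ k * (k ! : ℝ) ^ 2)) →
        (∀ k l : ℕ, KdVSystem.PointwiseBound x₀ t₀ ε l (KdVSystem.P^[k] u)
          (c₁ * A₃ ^ (k + l) * ((k + l)! : ℝ) ^ 2)) ∧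
        (∀ k l : ℕ, KdVSystem.PointwiseBound x₀ t₀ ε l (KdVSystem.P^[k] v)
          (c₁ * A₄ ^ (k + l) * ((k + l)! : ℝ) ^ 2)) := by
  -- The coupling mixes the two components, so the larger of A₁ and A₂ governs both and A₃ = A₄.
  obtain ⟨c₁, A, hc₁, hA, key⟩ := KdVSystem.pointwiseBound_of_sobolevNorm_le
    (KdVSystem.coeff a b c a' b' c') hε hεt hψ hψc hψ1 hC (A₀ := max A₁ A₂)
    (lt_max_of_lt_left hA₁)
  refine ⟨c₁, A, A, hc₁, hA, hA, fun u v ⟨f, g, _, _, hf, hg, hwu, hwv⟩ hu hv ↦ ?_⟩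
  have hU := KdVSystem.isOpen_square x₀ t₀ ε
  have h := key ![u, v] ?_ ?_
  · exact ⟨h 0, h 1⟩
  · intro α k
    have h1 : ∀ A' : ℝ, 0 < A' → A' ≤ max A₁ A₂ → ENNReal.ofReal (C * A' ^ k * (k ! : ℝ) ^ 2)
        ≤ ENNReal.ofReal (C * max A₁ A₂ ^ k * (k ! : ℝ) ^ 2) := fun A' hA' hle ↦
      ENNReal.ofReal_le_ofReal (by gcongr)
    fin_cases α
    · exact (hu k).trans (h1 A₁ hA₁ (le_max_left _ _))
    · exact (hv k).trans (h1 A₂ hA₂ (le_max_right _ _))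
  · intro V hV hVw α η hη
    have hVu := hVw 0 0
    have hVv := hVw 1 0
    simp only [KdVSystem.flux_zero]
    fin_cases α
    · refine (hwu.apply_eq hU hf hg (hV 0 0) (hV 1 0) hVu hVv hη).trans ?_
      simp [KdVSystem.coeff]
    · refine (hwv.apply_eq hU hf hg (hV 0 0) (hV 1 0) hVu hVv hη).trans ?_
      simp [KdVSystem.coeff]
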